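/- Let $L\ge 1$ be an integer and let $a_0,a_1,a_2,\dots$ be independent standard complex Gaussian random variables (real and imaginary parts independent, each $N(0,\tfrac12)$, so that $E a_m=0$, $E a_m\overline{a_n}=\delta_{mn}$, $E a_ma_n=0$). Consider the $SU(1,1)$ random analytic function $$\psi(z)=\sum_{m=0}^{\infty}\sqrt{\binom{m+L-1}{m}}\;a_m z^m .$$ Almost surely the series converges for all $|z|<1$, and for all $z,z'$ in the unit disk $$E\big(\psi(z)\overline{\psi(z')}\big)=\frac{1}{(1-z\overline{z'})^{L}} .$$ The density of the zeros of $\psi$ in the disk $\{|z|<1\}$ is $$\rho(z)=\frac{L}{\pi(1-|z|^2)^2},$$ that is: almost surely $\psi$ is analytic in the disk and has finitely many zeros in every compact subset of it, and for every infinitely differentiable function $\phi:\mathbb C\to\mathbb C$ with compact support contained in the disk, the random variable $\sum_j\phi(\zeta_j)$, where $\zeta_j$ are the zeros of $\psi$ in the disk repeated according to multiplicity, is integrable and $$E\Big(\sum_j\phi(\zeta_j)\Big)=\int_{|z|<1}\rho(z)\,\phi(z)\,dx\,dy .$$ Moreover, any locally integrable function on the disk with this last property equals $\rho$ almost everywhere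 in the disk. -/

import Mathlib

open MeasureTheory ProbabilityTheory Filter Topology
open scoped ComplexConjugate

/-- The law of a standard complex Gaussian variable `x + i y`: the real and imaginary parts are
independent real Gaussians of mean `0` and variance `1/2`, so that `E a = 0`, `E |a|² = 1` and
`E a² = 0`. -/
noncomputable def stdComplexGaussian : Measure ℂ :=
  ((gaussianReal 0 (1 / 2)).prod (gaussianReal 0 (1 / 2))).map
    (fun p : ℝ × ℝ => (p.1 : ℂ) + (p.2 : ℂ) * Complex.I)

/-- `a 0, a 1, a 2, …` are independent standard complex Gaussian random variables. -/
structure IsIIDStdComplexGaussian {Ω : Type*} [MeasurableSpace Ω] (P : Measure Ω)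
    (a : ℕ → Ω → ℂ) : Prop where
  hasLaw : ∀ m, HasLaw (a m) stdComplexGaussian P
  indep : iIndepFun a P

/-- The `m`-th term `√C(m+L-1, m) a_m z^m` (for `L ≥ 1`). -/
noncomputable def su11Term (L : ℕ) (a : ℕ → ℂ) (z : ℂ) (m : ℕ) : ℂ :=
  (Real.sqrt ((m + L - 1).choose m : ℝ) : ℂ) * a m * z ^ m

/-- The `SU(1,1)` analytic function `ψ(z) = ∑_{m ≥ 0} √C(m+L-1, m) a_m z^m` with coefficient
sequence `a`. -/
noncomputable def su11Function (L : ℕ) (a : ℕ → ℂ) (z : ℂ) : ℂ :=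
  ∑' m : ℕ, su11Term L a z m

/-- The linear statistic `∑_j φ(ζ_j)` over the zeros `ζ_j` of `f` in `U`, each zero being repeated
according to its multiplicity. -/
noncomputable def zeroSum (f : ℂ → ℂ) (U : Set ℂ) (φ : ℂ → ℂ) : ℂ :=
  ∑ᶠ z ∈ {z : ℂ | z ∈ U ∧ f z = 0}, (analyticOrderNatAt f z : ℂ) * φ z

/-- `ρ` is a density of the zeros of the random analytic function `ψ` in the open set `U`: almost
surely `ψ` is analytic in `U` with finitely many zeros in each compact subset of `U`, and
`E ∑_j φ(ζ_j) = ∫_U ρ φ dx dy` for every smooth `φ` with compact support in `U`, the random variable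
`∑_j φ(ζ_j)` being integrable. -/
structure IsZeroDensity {Ω : Type*} [MeasurableSpace Ω] (P : Measure Ω) (ψ : Ω → ℂ → ℂ)
    (U : Set ℂ) (ρ : ℂ → ℝ) : Prop where
  analytic : ∀ᵐ ω ∂P, AnalyticOnNhd ℂ (ψ ω) U
  finite_zeros : ∀ᵐ ω ∂P, ∀ K : Set ℂ, IsCompact K → K ⊆ U → {z : ℂ | z ∈ K ∧ ψ ω z = 0}.Finite
  locallyIntegrable : LocallyIntegrableOn ρ U volume
  integrable_zeroSum : ∀ φ : ℂ → ℂ, ContDiff ℝ (⊤ : ℕ∞) φ → HasCompactSupport φ → tsupport φ ⊆ U →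
    Integrable (fun ω => zeroSum (ψ ω) U φ) P
  integral_zeroSum : ∀ φ : ℂ → ℂ, ContDiff ℝ (⊤ : ℕ∞) φ → HasCompactSupport φ → tsupport φ ⊆ U →
    ∫ ω, zeroSum (ψ ω) U φ ∂P = ∫ z in U, (ρ z : ℂ) * φ z

/-! The zeros of an analytic `f`, counted with multiplicity, form the measure `(1/2π) Δ log|f|`.
Taking expectations, the mean zero measure of `ψ` is `(1/2π) Δ E log|ψ|`. For fixed `z` the value
`ψ(z)` is a standard complex Gaussian scaled by `(1 - |z|²)^(-L/2)`
(`IsIIDStdComplexGaussian.hasLaw_su11Function`), so `E log|ψ(z)| = C - (L/2) log(1 - |z|²)` with `C`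
independent of `z`, and `(1/2π) Δ` of this is `L / (π (1 - |z|²)²)`.

No distributional Laplacian is used: it is replaced by `2/(π r²)` times (circle average minus value
at the centre), divided out of any derivative and let `r → 0`. By Jensen's formula this operator
turns `log|f|` into the zeros convolved with a Newtonian kernel of mass one
(`AnalyticOnNhd.circleAverage_log_norm_sub`, `smoothedZeroSum_eq_sum`), hence the smoothed
statistics tend to the true one (`tendsto_smoothedZeroSum`). At fixed `r` the expectation passes
inside by Fubini (`integral_smoothedLaplacian`). The circle averages of `log(1 - |z|²)` have a
closed form (`circleAverage_log_one_sub_norm_sq`), which gives the limit on the deterministic side.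
On the random side dominated convergence applies, because all small scales are controlled by one
integrable smoothed count (`norm_smoothedZeroSum_le`). -/

/-! ### The Newtonian kernel as an approximate identity. -/

/-- The Newtonian kernel `2 / (π r²) · log⁺ (r / ‖w‖)`, of total mass one on the disk of
radius `r`. -/
noncomputable def logKernel (r : ℝ) (w : ℂ) : ℝ :=
  2 / (Real.pi * r ^ 2) * Real.posLog (r * ‖w‖⁻¹)

lemma logKernel_nonneg (r : ℝ) (w : ℂ) : 0 ≤ logKernel r w :=
  mul_nonneg (div_nonneg (by norm_num) (by positivity)) Real.posLog_nonneg

lemma logKernel_eq_zero {r : ℝ} (hr : 0 < r) {w : ℂ} (hw : r ≤ ‖w‖) : logKernel r w = 0 := by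
  have hw0 : 0 < ‖w‖ := hr.trans_le hw
  have : Real.posLog (r * ‖w‖⁻¹) = 0 := by
    rw [Real.posLog_eq_zero_iff, abs_of_nonneg (by positivity), ← div_eq_mul_inv]
    exact (div_le_one hw0).2 hw
  simp [logKernel, this]

lemma hasDerivAt_sq_mul_log {r y : ℝ} (hy : 0 < y) :
    HasDerivAt (fun y : ℝ => y ^ 2 / 2 * (Real.log r - Real.log y) + y ^ 2 / 4)
      (y * (Real.log r - Real.log y)) y := by
  have h1 : HasDerivAt (fun y : ℝ => y ^ 2) (2 * y) y := by simpa using hasDerivAt_pow 2 y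
  have h2 := (Real.hasDerivAt_log hy.ne').const_sub (Real.log r)
  have := ((h1.div_const 2).mul h2).add (h1.div_const 4)
  refine this.congr_deriv ?_
  field_simp
  ring

/-- This is the radial integral in polar coordinates; multiplied by `2π` it gives `π r² / 2`, whence
the normalisation of `logKernel`. -/
lemma integral_mul_log_div {r : ℝ} (hr : 0 < r) :
    IntervalIntegrable (fun y : ℝ => y * (Real.log r - Real.log y)) volume 0 r ∧
    ∫ y in (0 : ℝ)..r, y * (Real.log r - Real.log y) = r ^ 2 / 4 := by
  have hc : Continuous (fun y : ℝ => y * (Real.log r - Real.log y)) := by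
    have : Continuous fun y : ℝ => y * Real.log r - y * Real.log y :=
      (by fun_prop : Continuous fun y : ℝ => y * Real.log r).sub Real.continuous_mul_log
    simpa [mul_sub] using this
  have hF : Continuous (fun y : ℝ => y ^ 2 / 2 * (Real.log r - Real.log y) + y ^ 2 / 4) := by
    have : Continuous fun y : ℝ => y / 2 * (y * (Real.log r - Real.log y)) + y ^ 2 / 4 := by
      fun_prop
    convert this using 2
    ring
  refine ⟨hc.intervalIntegrable _ _, ?_⟩
  rw [intervalIntegral.integral_eq_sub_of_hasDerivAt_of_le hr.le hF.continuousOn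
    (fun y hy => hasDerivAt_sq_mul_log hy.1) (hc.intervalIntegrable _ _)]
  simp

lemma posLog_mul_inv_of_mem {r y : ℝ} (hy : 0 < y) (hyr : y ≤ r) :
    Real.posLog (r * y⁻¹) = Real.log r - Real.log y := by
  have hr := hy.trans_le hyr
  rw [Real.posLog_eq_log, Real.log_mul hr.ne' (by positivity), Real.log_inv, sub_eq_add_neg]
  rw [abs_of_nonneg (by positivity), ← div_eq_mul_inv]
  exact (one_le_div hy).2 hyr

lemma radial_posLog_eq_indicator {r : ℝ} (hr : 0 < r) {y : ℝ} (hy : y ∈ Set.Ioi (0 : ℝ)) :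
    y * Real.posLog (r * y⁻¹) =
      (Set.Ioc 0 r).indicator (fun y : ℝ => y * (Real.log r - Real.log y)) y := by
  have hy : 0 < y := hy
  by_cases h : y ≤ r
  · rw [Set.indicator_of_mem (show y ∈ Set.Ioc 0 r from ⟨hy, h⟩), posLog_mul_inv_of_mem hy h]
  · rw [Set.indicator_of_notMem (fun h' => h h'.2)]
    have : Real.posLog (r * y⁻¹) = 0 := by
      rw [Real.posLog_eq_zero_iff, abs_of_nonneg (by positivity), ← div_eq_mul_inv]
      exact (div_le_one hy).2 (not_le.1 h).le
    simp [this]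

lemma integrable_posLog_norm {r : ℝ} (hr : 0 < r) :
    Integrable (fun w : ℂ => Real.posLog (r * ‖w‖⁻¹)) := by
  rw [integrable_fun_norm_addHaar volume (f := fun y => Real.posLog (r * y⁻¹))]
  simp only [Complex.finrank_real_complex, Nat.add_one_sub_one, pow_one, smul_eq_mul]
  rw [integrableOn_congr_fun (fun y hy => radial_posLog_eq_indicator hr hy) measurableSet_Ioi]
  have := (intervalIntegrable_iff_integrableOn_Ioc_of_le hr.le).1 (integral_mul_log_div hr).1
  exact ((integrable_indicator_iff measurableSet_Ioc).2 this).integrableOn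

lemma integral_posLog_norm {r : ℝ} (hr : 0 < r) :
    ∫ w : ℂ, Real.posLog (r * ‖w‖⁻¹) = Real.pi * r ^ 2 / 2 := by
  rw [integral_fun_norm_addHaar volume (fun y => Real.posLog (r * y⁻¹))]
  simp only [Complex.finrank_real_complex, Nat.add_one_sub_one, pow_one, smul_eq_mul]
  rw [setIntegral_congr_fun measurableSet_Ioi (fun y hy => radial_posLog_eq_indicator hr hy),
    setIntegral_indicator measurableSet_Ioc,
    Set.inter_eq_right.2 (Set.Ioc_subset_Ioi_self), ← intervalIntegral.integral_of_le hr.le,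
    (integral_mul_log_div hr).2]
  simp [Measure.real, Complex.volume_ball]
  ring

lemma integrable_logKernel {r : ℝ} (hr : 0 < r) : Integrable (logKernel r) :=
  (integrable_posLog_norm hr).const_mul _

lemma integral_logKernel {r : ℝ} (hr : 0 < r) : ∫ w, logKernel r w = 1 := by
  unfold logKernel
  rw [integral_const_mul, integral_posLog_norm hr]
  field_simp

lemma integrable_logKernel_sub {r : ℝ} (hr : 0 < r) (ζ : ℂ) :
    Integrable (fun c => logKernel r (c - ζ)) :=
  (integrable_logKernel hr).comp_sub_right ζ

lemma integral_logKernel_sub {r : ℝ} (hr : 0 < r) (ζ : ℂ) :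
    ∫ c, logKernel r (c - ζ) = 1 := by
  rw [integral_sub_right_eq_self (logKernel r) ζ, integral_logKernel hr]

/-- Averages against the Newtonian kernel are dominated by the bound of the function near the
centre. -/
lemma norm_integral_mul_logKernel_le {r M : ℝ} (hr : 0 < r) {ζ : ℂ} {g : ℂ → ℂ}
    (hg : ∀ c, ‖c - ζ‖ < r → ‖g c‖ ≤ M) :
    ‖∫ c, g c * (logKernel r (c - ζ) : ℂ)‖ ≤ M := by
  have h : ∀ c, ‖g c * (logKernel r (c - ζ) : ℂ)‖ ≤ M * logKernel r (c - ζ) := by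
    intro c
    rw [norm_mul, Complex.norm_real, Real.norm_of_nonneg (logKernel_nonneg _ _)]
    by_cases hc : ‖c - ζ‖ < r
    · exact mul_le_mul_of_nonneg_right (hg c hc) (logKernel_nonneg _ _)
    · simp [logKernel_eq_zero hr (not_lt.1 hc)]
  calc ‖∫ c, g c * (logKernel r (c - ζ) : ℂ)‖ ≤ ∫ c, M * logKernel r (c - ζ) :=
        norm_integral_le_of_norm_le ((integrable_logKernel_sub hr ζ).const_mul M)
          (Eventually.of_forall h)
    _ = M := by rw [integral_const_mul, integral_logKernel_sub hr, mul_one]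

lemma integrable_mul_logKernel {r M : ℝ} (hr : 0 < r) (ζ : ℂ) {g : ℂ → ℂ}
    (hgm : Measurable g) (hg : ∀ c, ‖g c‖ ≤ M) :
    Integrable (fun c => g c * (logKernel r (c - ζ) : ℂ)) :=
  (integrable_logKernel_sub hr ζ).ofReal.bdd_mul hgm.aestronglyMeasurable
    (Eventually.of_forall hg)

/-- The Newtonian kernels form an approximate identity. -/
lemma tendsto_integral_mul_logKernel {g : ℂ → ℂ} (hg : Continuous g) {M : ℝ}
    (hM : ∀ c, ‖g c‖ ≤ M) (ζ : ℂ) :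
    Tendsto (fun r => ∫ c, g c * (logKernel r (c - ζ) : ℂ)) (𝓝[>] 0) (𝓝 (g ζ)) := by
  rw [Metric.tendsto_nhds]
  intro ε hε
  obtain ⟨δ, hδ, h⟩ := Metric.continuous_iff.1 hg ζ (ε / 2) (half_pos hε)
  filter_upwards [Ioo_mem_nhdsGT hδ] with r hr
  have h1 : (∫ c, g c * (logKernel r (c - ζ) : ℂ)) - g ζ =
      ∫ c, (g c - g ζ) * (logKernel r (c - ζ) : ℂ) := by
    simp_rw [sub_mul]
    rw [integral_sub (integrable_mul_logKernel hr.1 ζ hg.measurable hM)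
      (integrable_mul_logKernel (M := ‖g ζ‖) hr.1 ζ measurable_const fun _ => le_rfl),
      integral_const_mul, integral_complex_ofReal, integral_logKernel_sub hr.1 ζ]
    simp
  rw [dist_eq_norm, h1]
  refine (norm_integral_mul_logKernel_le hr.1 (fun c hc => ?_)).trans_lt (half_lt_self hε)
  rw [← dist_eq_norm]
  exact (h c (by rw [dist_eq_norm]; exact hc.trans hr.2)).le

/-! ### Jensen's formula and smoothed sums over zeros. -/

lemma AnalyticOnNhd.finite_zeros_inter_compact {f : ℂ → ℂ} {U K : Set ℂ}
    (hf : AnalyticOnNhd ℂ f U) (hU : IsPreconnected U) (hne : ∃ z ∈ U, f z ≠ 0)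
    (hK : IsCompact K) (hKU : K ⊆ U) : {z : ℂ | z ∈ K ∧ f z = 0}.Finite := by
  by_contra hinf
  obtain ⟨x, hxK, hx⟩ := Set.Infinite.exists_accPt_of_subset_isCompact hinf hK fun z hz => hz.1
  obtain ⟨z, hz, hfz⟩ := hne
  refine hfz (hf.eqOn_zero_of_preconnected_of_frequently_eq_zero hU (hKU hxK) ?_ hz)
  exact (accPt_iff_frequently_nhdsNE.1 hx).mono fun y hy => hy.2

/-- Jensen's formula on a small disk, the zeros being taken in a fixed larger set. -/
lemma AnalyticOnNhd.circleAverage_log_norm_sub {f : ℂ → ℂ} {U K : Set ℂ}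
    (hf : AnalyticOnNhd ℂ f U) (hKU : K ⊆ U) {S : Finset ℂ} (hS : ∀ z, z ∈ S ↔ z ∈ K ∧ f z = 0)
    {c : ℂ} {r : ℝ} (hr : 0 < r) (hc : Metric.closedBall c r ⊆ K) (hfc : f c ≠ 0) :
    Real.circleAverage (fun z => Real.log ‖f z‖) c r - Real.log ‖f c‖ =
      ∑ ζ ∈ S, (analyticOrderNatAt f ζ : ℝ) * Real.posLog (r * ‖c - ζ‖⁻¹) := by
  have hf' : AnalyticOnNhd ℂ f (Metric.closedBall c r) := hf.mono (hc.trans hKU)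
  have hjensen := AnalyticOnNhd.circleAverage_log_norm hr.ne' (by rwa [abs_of_pos hr]) hfc
  rw [hjensen, add_sub_cancel_right, abs_of_pos hr]
  rw [finsum_eq_sum_of_support_subset (s := S)]
  · refine Finset.sum_congr rfl fun ζ hζ => ?_
    have hζ0 := ((hS ζ).1 hζ).2
    have hcζ : 0 < ‖c - ζ‖ := by
      rw [norm_pos_iff, sub_ne_zero]
      rintro rfl
      exact hfc hζ0
    -- Zeros of `S` outside the disk contribute nothing on either side: the divisor vanishes there,
    -- and so does `log⁺`. This is what allows `S` not to depend on `c`.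
    by_cases h : ζ ∈ Metric.closedBall c r
    · rw [MeromorphicOn.AnalyticOnNhd.divisor_apply hf' h, Real.posLog_eq_log]
      · congr 1
        unfold analyticOrderNatAt
        cases analyticOrderAt f ζ <;> simp
      · rw [abs_of_nonneg (by positivity), ← div_eq_mul_inv]
        refine (one_le_div hcζ).2 ?_
        rwa [← dist_eq_norm, dist_comm]
    · rw [Function.locallyFinsuppWithin.apply_eq_zero_of_notMem _ h]
      have : Real.posLog (r * ‖c - ζ‖⁻¹) = 0 := by
        rw [Real.posLog_eq_zero_iff, abs_of_nonneg (by positivity), ← div_eq_mul_inv]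
        refine (div_le_one hcζ).2 ?_
        rw [Metric.mem_closedBall, not_le, dist_comm, dist_eq_norm] at h
        exact h.le
      simp [this]
  · intro ζ hζ
    rw [Function.mem_support] at hζ
    have h : ζ ∈ Metric.closedBall c r := by
      by_contra h
      rw [Function.locallyFinsuppWithin.apply_eq_zero_of_notMem _ h] at hζ
      simp at hζ
    refine (hS ζ).2 ⟨hc h, ?_⟩
    by_contra h0
    rw [MeromorphicOn.AnalyticOnNhd.divisor_apply hf' h, (hf' ζ h).analyticOrderAt_eq_zero.2 h0] at hζ
    simp at hζ

/-- The integral of `φ` against `1 / (2π)` times the Laplacian of `u`, the Laplacian being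
approximated by circle averages at scale `r`. -/
noncomputable def smoothedLaplacian (u : ℂ → ℝ) (r : ℝ) (φ : ℂ → ℂ) : ℂ :=
  ∫ c, φ c * ((2 / (Real.pi * r ^ 2) * (Real.circleAverage u c r - u c) : ℝ) : ℂ)

/-- The smoothing of the linear statistic `zeroSum f U φ` at scale `r`, expressed through
circle averages of `log ‖f‖`. -/
noncomputable def smoothedZeroSum (f : ℂ → ℂ) (r : ℝ) (φ : ℂ → ℂ) : ℂ :=
  smoothedLaplacian (fun z => Real.log ‖f z‖) r φ

lemma zeroSum_eq_sum {f : ℂ → ℂ} {U K : Set ℂ} (hKU : K ⊆ U) {S : Finset ℂ}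
    (hS : ∀ z, z ∈ S ↔ z ∈ K ∧ f z = 0) {φ : ℂ → ℂ} (hφ : ∀ z, z ∉ K → φ z = 0) :
    zeroSum f U φ = ∑ ζ ∈ S, (analyticOrderNatAt f ζ : ℂ) * φ ζ := by
  unfold zeroSum
  refine finsum_mem_eq_sum_of_inter_support_eq _ ?_
  ext z
  simp only [Set.mem_inter_iff, Set.mem_ofPred_eq, Function.mem_support, Finset.mem_coe, hS,
    and_congr_left_iff]
  intro hz
  have : z ∈ K := by
    by_contra h
    exact hz (by rw [hφ z h, mul_zero])
  simp [this, hKU this]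

/-- Jensen's formula is applied at every centre `c` that is not a zero, hence almost everywhere, and
then summation and integration are exchanged. The condition `R + r ≤ R'` keeps every disk centred in
the support of `φ` inside the region whose zeros `S` lists. -/
lemma smoothedZeroSum_eq_sum {f : ℂ → ℂ} {U : Set ℂ} (hf : AnalyticOnNhd ℂ f U) {R R' r M : ℝ}
    (hU : Metric.closedBall 0 R' ⊆ U) {S : Finset ℂ}
    (hS : ∀ z, z ∈ S ↔ z ∈ Metric.closedBall 0 R' ∧ f z = 0) (hr : 0 < r) (hR : R + r ≤ R')
    {φ : ℂ → ℂ} (hφm : Measurable φ) (hφM : ∀ z, ‖φ z‖ ≤ M)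
    (hφ : ∀ z, z ∉ Metric.closedBall 0 R → φ z = 0) :
    smoothedZeroSum f r φ =
      ∑ ζ ∈ S, (analyticOrderNatAt f ζ : ℂ) * ∫ c, φ c * (logKernel r (c - ζ) : ℂ) := by
  simp_rw [← integral_const_mul, smoothedZeroSum, smoothedLaplacian]
  rw [← integral_finsetSum _ fun ζ _ => (integrable_mul_logKernel hr ζ hφm hφM).const_mul _]
  refine integral_congr_ae ?_
  have hae : ∀ᵐ c : ℂ, c ∉ S := S.finite_toSet.measure_zero volume |> compl_mem_ae_iff.2
  filter_upwards [hae] with c hc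
  by_cases hcR : c ∈ Metric.closedBall 0 R
  · have hsub : Metric.closedBall c r ⊆ Metric.closedBall 0 R' :=
      Metric.closedBall_subset_closedBall' (by
        have := Metric.mem_closedBall.1 hcR
        linarith)
    have hfc : f c ≠ 0 := fun h =>
      hc ((hS c).2 ⟨hsub (Metric.mem_closedBall_self hr.le), h⟩)
    rw [hf.circleAverage_log_norm_sub hU hS hr hsub hfc]
    simp only [logKernel, Finset.mul_sum, Complex.ofReal_sum]
    refine Finset.sum_congr rfl fun ζ _ => ?_
    push_cast
    ring
  · simp [hφ c hcR]

lemma tendsto_smoothedZeroSum {f : ℂ → ℂ} {U : Set ℂ} (hf : AnalyticOnNhd ℂ f U)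
    (hUc : IsPreconnected U) (hne : ∃ z ∈ U, f z ≠ 0) {R R' : ℝ} (hR : R < R')
    (hU : Metric.closedBall 0 R' ⊆ U) {φ : ℂ → ℂ} (hφc : Continuous φ)
    (hφ : ∀ z, z ∉ Metric.closedBall 0 R → φ z = 0) :
    Tendsto (fun r => smoothedZeroSum f r φ) (𝓝[>] 0) (𝓝 (zeroSum f U φ)) := by
  have hfin := hf.finite_zeros_inter_compact hUc hne (isCompact_closedBall 0 R') hU
  have hS : ∀ z, z ∈ hfin.toFinset ↔ z ∈ Metric.closedBall 0 R' ∧ f z = 0 := by simp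
  obtain ⟨M, hM⟩ := hφc.bounded_above_of_compact_support
    (HasCompactSupport.intro (isCompact_closedBall 0 R) hφ)
  rw [zeroSum_eq_sum hU hS fun z hz =>
    hφ z fun h => hz (Metric.closedBall_subset_closedBall hR.le h)]
  refine Tendsto.congr' (f₁ := fun r => ∑ ζ ∈ hfin.toFinset, (analyticOrderNatAt f ζ : ℂ) *
    ∫ c, φ c * (logKernel r (c - ζ) : ℂ)) ?_
    (tendsto_finsetSum _ fun ζ _ => (tendsto_integral_mul_logKernel hφc hM ζ).const_mul _)
  filter_upwards [Ioo_mem_nhdsGT (sub_pos.2 hR)] with r hr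
  exact (smoothedZeroSum_eq_sum hf hU hS hr.1 (by linarith [hr.2]) hφc.measurable hM hφ).symm

/-- All small-scale smoothings of a linear statistic are dominated by a single smoothed count of
zeros. -/
lemma norm_smoothedZeroSum_le {f : ℂ → ℂ} {U : Set ℂ} (hf : AnalyticOnNhd ℂ f U)
    (hUc : IsPreconnected U) (hne : ∃ z ∈ U, f z ≠ 0) {R δ r M : ℝ} (hr : 0 < r) (hrδ : r ≤ δ)
    (hU : Metric.closedBall 0 (R + 3 * δ) ⊆ U) {φ : ℂ → ℂ} (hφm : Measurable φ)
    (hφM : ∀ z, ‖φ z‖ ≤ M) (hφ : ∀ z, z ∉ Metric.closedBall 0 R → φ z = 0) :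
    ‖smoothedZeroSum f r φ‖ ≤ M *
      ‖smoothedZeroSum f δ ((Metric.closedBall 0 (R + 2 * δ)).indicator fun _ => 1)‖ := by
  have hδ := hr.trans_le hrδ
  have hM : 0 ≤ M := (norm_nonneg _).trans (hφM 0)
  set χ : ℂ → ℂ := (Metric.closedBall 0 (R + 2 * δ)).indicator fun _ => 1
  have hfin := hf.finite_zeros_inter_compact hUc hne (isCompact_closedBall 0 _) hU
  have hS : ∀ z, z ∈ hfin.toFinset ↔ z ∈ Metric.closedBall 0 (R + 3 * δ) ∧ f z = 0 := by simp
  have hχM : ∀ z, ‖χ z‖ ≤ 1 := fun z => by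
    by_cases h : z ∈ Metric.closedBall (0 : ℂ) (R + 2 * δ) <;> simp [χ, h]
  have hχm : Measurable χ := measurable_const.indicator Metric.isClosed_closedBall.measurableSet
  rw [smoothedZeroSum_eq_sum hf hU hS hr (by linarith) hφm hφM hφ,
    smoothedZeroSum_eq_sum hf hU hS hδ (by linarith) hχm hχM
      (fun z hz => Set.indicator_of_notMem hz _)]
  set ind : ℂ → ℝ := fun c => (Metric.closedBall (0 : ℂ) (R + 2 * δ)).indicator (fun _ => 1) c
  have hχ : ∀ ζ, ∫ c, χ c * (logKernel δ (c - ζ) : ℂ) =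
      ((∫ c, ind c * logKernel δ (c - ζ) : ℝ) : ℂ) := by
    intro ζ
    rw [← integral_complex_ofReal]
    refine integral_congr_ae (Eventually.of_forall fun c => ?_)
    by_cases h : c ∈ Metric.closedBall (0 : ℂ) (R + 2 * δ)
    · simp only [χ, ind, Set.indicator_of_mem h, one_mul]
    · simp only [χ, ind, Set.indicator_of_notMem h, zero_mul, Complex.ofReal_zero]
  have hpos : ∀ ζ, 0 ≤ ∫ c, ind c * logKernel δ (c - ζ) := fun ζ =>
    integral_nonneg fun c => mul_nonneg (Set.indicator_nonneg (fun _ _ => zero_le_one) _)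
      (logKernel_nonneg _ _)
  simp_rw [hχ]
  have hcast : ∑ ζ ∈ hfin.toFinset, (analyticOrderNatAt f ζ : ℂ) *
      ((∫ c, ind c * logKernel δ (c - ζ) : ℝ) : ℂ) =
      ((∑ ζ ∈ hfin.toFinset, (analyticOrderNatAt f ζ : ℝ) *
        (∫ c, ind c * logKernel δ (c - ζ)) : ℝ) : ℂ) := by push_cast; rfl
  rw [hcast, Complex.norm_real, Real.norm_of_nonneg
    (Finset.sum_nonneg fun ζ _ => mul_nonneg (Nat.cast_nonneg _) (hpos ζ)), Finset.mul_sum]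
  refine (norm_sum_le _ _).trans (Finset.sum_le_sum fun ζ _ => ?_)
  rw [norm_mul, Complex.norm_natCast, mul_left_comm]
  refine mul_le_mul_of_nonneg_left ?_ (Nat.cast_nonneg _)
  -- For zeros within `R + δ` the cutoff at `R + 2δ` equals one on the whole kernel disk of radius
  -- `δ`, so the count has weight exactly one. For the others a kernel of radius `r ≤ δ` does not
  -- reach the support of `φ`. The radius `R + 3δ` leaves room for the disks of radius `δ` around
  -- the cutoff.
  by_cases hζ : ‖ζ‖ ≤ R + δ
  · have : ∫ c, ind c * logKernel δ (c - ζ) = 1 := by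
      rw [← integral_logKernel_sub hδ ζ]
      refine integral_congr_ae (Eventually.of_forall fun c => ?_)
      by_cases hc : ‖c - ζ‖ < δ
      · have : c ∈ Metric.closedBall (0 : ℂ) (R + 2 * δ) := by
          rw [mem_closedBall_zero_iff]
          calc ‖c‖ = ‖(c - ζ) + ζ‖ := by rw [sub_add_cancel]
            _ ≤ ‖c - ζ‖ + ‖ζ‖ := norm_add_le _ _
            _ ≤ R + 2 * δ := by linarith
        simp only [ind, Set.indicator_of_mem this, one_mul]
      · simp [logKernel_eq_zero hδ (not_lt.1 hc)]
    rw [this, mul_one]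
    exact norm_integral_mul_logKernel_le hr fun c _ => hφM c
  · refine (norm_integral_mul_logKernel_le (M := 0) hr fun c hc => ?_).trans
      (mul_nonneg hM (hpos ζ))
    rw [hφ c, norm_zero]
    rw [mem_closedBall_zero_iff]
    intro h
    have : ‖ζ‖ ≤ ‖c - ζ‖ + ‖c‖ := by
      rw [norm_sub_rev]
      simpa using norm_add_le (ζ - c) c
    linarith

/-! ### Exchanging expectation and smoothed Laplacian. -/

/-- By Tonelli, a first absolute moment bounded uniformly on `K` is enough on a finite measure
space. The map `q` lets one statement serve both the centres and the points on the circles. -/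
lemma integrable_prod_bounded_mul_field {Ω S : Type*} [MeasurableSpace Ω] [MeasurableSpace S]
    {P : Measure Ω} [IsProbabilityMeasure P] {μ : Measure S} [IsFiniteMeasure μ]
    {g : Ω → ℂ → ℝ} (hg : Measurable (Function.uncurry g)) {K : Set ℂ} {B M : ℝ}
    (hint : ∀ z ∈ K, Integrable (fun ω => g ω z) P) (hB : ∀ z ∈ K, ∫ ω, |g ω z| ∂P ≤ B)
    {q : S → ℂ} (hq : Measurable q) (hqK : ∀ᵐ s ∂μ, q s ∈ K)
    {w : S → ℂ} (hw : Measurable w) (hwM : ∀ s, ‖w s‖ ≤ M) :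
    Integrable (fun p : Ω × S => w p.2 * (g p.1 (q p.2) : ℂ)) (P.prod μ) := by
  have hgq : Measurable fun p : Ω × S => g p.1 (q p.2) :=
    hg.comp (measurable_fst.prodMk (hq.comp measurable_snd))
  refine Integrable.bdd_mul (c := M) ?_ (hw.comp measurable_snd).aestronglyMeasurable
    (Eventually.of_forall fun p => hwM p.2)
  refine Integrable.ofReal ?_
  rw [integrable_prod_iff' hgq.aestronglyMeasurable]
  refine ⟨hqK.mono fun s hs => hint _ hs, ?_⟩
  refine Integrable.of_bound (C := B) ?_ (hqK.mono fun s hs => ?_)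
  · exact hgq.norm.stronglyMeasurable.integral_prod_left'.aestronglyMeasurable
  · rw [Real.norm_of_nonneg (integral_nonneg fun _ => norm_nonneg _)]
    exact hB _ hs

/-- Unfolding the circle average into an integral over (centre, angle) leaves two plain integrals,
each ready for a Fubini swap with the expectation. -/
lemma smoothedLaplacian_eq {u : ℂ → ℝ} {R r : ℝ} {φ : ℂ → ℂ}
    (hφ : ∀ z, z ∉ Metric.closedBall 0 R → φ z = 0)
    (h1 : Integrable (fun p : ℂ × ℝ => φ p.1 * (u (circleMap p.1 r p.2) : ℂ))
      ((volume.restrict (Metric.closedBall 0 R)).prod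
        (volume.restrict (Set.Ioc 0 (2 * Real.pi)))))
    (h0 : Integrable (fun c => φ c * (u c : ℂ)) (volume.restrict (Metric.closedBall 0 R))) :
    smoothedLaplacian u r φ = ((2 / (Real.pi * r ^ 2) : ℝ) : ℂ) *
      (((2 * Real.pi)⁻¹ : ℝ) * ∫ p, φ p.1 * (u (circleMap p.1 r p.2) : ℂ)
        ∂((volume.restrict (Metric.closedBall 0 R)).prod
          (volume.restrict (Set.Ioc 0 (2 * Real.pi)))) -
        ∫ c in Metric.closedBall 0 R, φ c * (u c : ℂ)) := by
  unfold smoothedLaplacian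
  rw [← setIntegral_eq_integral_of_forall_compl_eq_zero (s := Metric.closedBall 0 R)
    (fun c hc => by rw [hφ c hc, zero_mul]), integral_prod _ h1, ← integral_const_mul,
    ← integral_sub (h1.integral_prod_left.const_mul _) h0, ← integral_const_mul]
  refine integral_congr_ae (Eventually.of_forall fun c => ?_)
  simp only [Real.circleAverage_def, intervalIntegral.integral_of_le Real.two_pi_pos.le,
    smul_eq_mul, integral_const_mul, integral_complex_ofReal]
  push_cast
  ring

/-- Expectation commutes with the smoothed Laplacian. -/
lemma integral_smoothedLaplacian {Ω : Type*} [MeasurableSpace Ω]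
    {P : Measure Ω} [IsProbabilityMeasure P] {g : Ω → ℂ → ℝ}
    (hg : Measurable (Function.uncurry g)) {R R' r B M : ℝ} (hr : 0 < r) (hR : R + r ≤ R')
    (hint : ∀ z ∈ Metric.closedBall (0 : ℂ) R', Integrable (fun ω => g ω z) P)
    (hB : ∀ z ∈ Metric.closedBall (0 : ℂ) R', ∫ ω, |g ω z| ∂P ≤ B)
    {φ : ℂ → ℂ} (hφm : Measurable φ) (hφM : ∀ z, ‖φ z‖ ≤ M)
    (hφ : ∀ z, z ∉ Metric.closedBall 0 R → φ z = 0) :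
    Integrable (fun ω => smoothedLaplacian (g ω) r φ) P ∧
    ∫ ω, smoothedLaplacian (g ω) r φ ∂P =
      smoothedLaplacian (fun z => ∫ ω, g ω z ∂P) r φ := by
  set ν := (volume : Measure ℂ).restrict (Metric.closedBall 0 R)
  set τ := (volume : Measure ℝ).restrict (Set.Ioc 0 (2 * Real.pi))
  have : IsFiniteMeasure ν := ⟨by
    rw [Measure.restrict_apply_univ]
    exact measure_closedBall_lt_top⟩
  have hν : ∀ᵐ c ∂ν, c ∈ Metric.closedBall (0 : ℂ) R :=
    ae_restrict_mem Metric.isClosed_closedBall.measurableSet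
  have I0 : Integrable (fun p : Ω × ℂ => φ p.2 * (g p.1 p.2 : ℂ)) (P.prod ν) :=
    integrable_prod_bounded_mul_field (μ := ν) hg hint hB measurable_id
    (hν.mono fun c hc => Metric.closedBall_subset_closedBall (by linarith) hc) hφm hφM
  have hq : Measurable fun p : ℂ × ℝ => circleMap p.1 r p.2 := by
    unfold circleMap
    fun_prop
  have hqK : ∀ᵐ p ∂(ν.prod τ), circleMap p.1 r p.2 ∈ Metric.closedBall (0 : ℂ) R' := by
    have h := (Measure.quasiMeasurePreserving_fst (μ := ν) (ν := τ)).ae hν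
    filter_upwards [h] with p hp
    have h1 := circleMap_mem_closedBall p.1 hr.le p.2
    rw [Metric.mem_closedBall] at *
    linarith [dist_triangle (circleMap p.1 r p.2) p.1 0]
  have I1 : Integrable (fun p : Ω × (ℂ × ℝ) =>
      φ p.2.1 * (g p.1 (circleMap p.2.1 r p.2.2) : ℂ)) (P.prod (ν.prod τ)) :=
    integrable_prod_bounded_mul_field (μ := ν.prod τ) hg hint hB hq hqK
    (hφm.comp measurable_fst) (fun p => hφM p.1)
  have hE : ∀ᵐ ω ∂P, smoothedLaplacian (g ω) r φ = ((2 / (Real.pi * r ^ 2) : ℝ) : ℂ) *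
      (((2 * Real.pi)⁻¹ : ℝ) * ∫ p, φ p.1 * (g ω (circleMap p.1 r p.2) : ℂ) ∂(ν.prod τ) -
        ∫ c, φ c * (g ω c : ℂ) ∂ν) := by
    filter_upwards [I0.prod_right_ae, I1.prod_right_ae] with ω h0 h1
    exact smoothedLaplacian_eq hφ h1 h0
  have hswap0 : ∫ ω, ∫ c, φ c * (g ω c : ℂ) ∂ν ∂P =
      ∫ c, φ c * ((∫ ω, g ω c ∂P : ℝ) : ℂ) ∂ν := by
    rw [integral_integral_swap I0]
    simp only [integral_const_mul, integral_complex_ofReal]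
  have hswap1 : ∫ ω, ∫ p, φ p.1 * (g ω (circleMap p.1 r p.2) : ℂ) ∂(ν.prod τ) ∂P =
      ∫ p, φ p.1 * ((∫ ω, g ω (circleMap p.1 r p.2) ∂P : ℝ) : ℂ) ∂(ν.prod τ) := by
    rw [integral_integral_swap I1]
    simp only [integral_const_mul, integral_complex_ofReal]
  have J0 := I0.integral_prod_left
  have J1 := I1.integral_prod_left
  refine ⟨(((J1.const_mul _).sub J0).const_mul _).congr (hE.mono fun ω h => h.symm), ?_⟩
  rw [integral_congr_ae hE, integral_const_mul, integral_sub (J1.const_mul _) J0,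
    integral_const_mul]
  have E0 := I0.integral_prod_right
  have E1 := I1.integral_prod_right
  simp only [integral_const_mul, integral_complex_ofReal] at E0 E1
  rw [smoothedLaplacian_eq hφ E1 E0]
  exact congrArg₂ (fun a b => ((2 / (Real.pi * r ^ 2) : ℝ) : ℂ) *
    (((2 * Real.pi)⁻¹ : ℝ) * a - b)) hswap1 hswap0

/-! ### The standard complex Gaussian law. -/

lemma measurable_ofReal_add_mul_I :
    Measurable fun p : ℝ × ℝ => (p.1 : ℂ) + (p.2 : ℂ) * Complex.I := by fun_prop

instance : IsProbabilityMeasure stdComplexGaussian :=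
  Measure.isProbabilityMeasure_map measurable_ofReal_add_mul_I.aemeasurable

lemma charFun_stdComplexGaussian (t : ℂ) :
    charFun stdComplexGaussian t = Complex.exp (-((‖t‖ ^ 2 / 4 : ℝ) : ℂ)) := by
  have h : ∀ x y : ℝ, Complex.exp ((inner ℝ ((x : ℂ) + y * Complex.I) t : ℝ) * Complex.I) =
      Complex.exp ((inner ℝ x t.re : ℝ) * Complex.I) *
        Complex.exp ((inner ℝ y t.im : ℝ) * Complex.I) := by
    intro x y
    rw [← Complex.exp_add]
    congr 1
    simp [Complex.inner]
    ring
  rw [charFun_apply, stdComplexGaussian,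
    integral_map measurable_ofReal_add_mul_I.aemeasurable (by fun_prop)]
  simp_rw [h]
  rw [integral_prod_mul (fun x : ℝ => Complex.exp ((inner ℝ x t.re : ℝ) * Complex.I))
    (fun y : ℝ => Complex.exp ((inner ℝ y t.im : ℝ) * Complex.I)), ← charFun_apply,
    ← charFun_apply, charFun_gaussianReal, charFun_gaussianReal, ← Complex.exp_add]
  congr 1
  rw [← Complex.normSq_eq_norm_sq, Complex.normSq_apply]
  push_cast
  ring

/-- The density is at most `1/√π < 1`. The comparison with Lebesgue measure serves to transfer null
sets and the integrability of the logarithmic singularity. -/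
lemma gaussianReal_half_le_volume : gaussianReal 0 (1 / 2) ≤ volume := by
  rw [gaussianReal_of_var_ne_zero _ (by norm_num)]
  calc volume.withDensity (gaussianPDF 0 (1 / 2)) ≤ volume.withDensity 1 := by
        refine withDensity_mono (Eventually.of_forall fun x => ?_)
        simp only [gaussianPDF, Pi.one_apply, ENNReal.ofReal_le_one, gaussianPDFReal]
        refine mul_le_one₀ (inv_le_one_of_one_le₀ ?_) (Real.exp_pos _).le ?_
        · rw [Real.one_le_sqrt]
          push_cast
          linarith [Real.pi_gt_three]
        · rw [Real.exp_le_one_iff]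
          exact div_nonpos_of_nonpos_of_nonneg (neg_nonpos.2 (sq_nonneg _)) (by positivity)
    _ = volume := withDensity_one

lemma stdComplexGaussian_le_volume : stdComplexGaussian ≤ volume := by
  have h : MeasurePreserving (fun p : ℝ × ℝ => (p.1 : ℂ) + (p.2 : ℂ) * Complex.I) := by
    convert Complex.volume_preserving_equiv_real_prod.symm using 1
    ext p
    apply Complex.ext <;> simp
  calc stdComplexGaussian
      ≤ ((volume : Measure ℝ).prod (volume : Measure ℝ)).map
        (fun p : ℝ × ℝ => (p.1 : ℂ) + (p.2 : ℂ) * Complex.I) :=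
        Measure.map_mono (Measure.prod_mono gaussianReal_half_le_volume
          gaussianReal_half_le_volume) measurable_ofReal_add_mul_I
    _ = volume := h.map_eq

lemma memLp_stdComplexGaussian : MemLp (fun w : ℂ => w) 2 stdComplexGaussian := by
  rw [stdComplexGaussian, memLp_map_measure_iff (by fun_prop)
    measurable_ofReal_add_mul_I.aemeasurable]
  have h : MemLp (fun x : ℝ => (x : ℂ)) 2 (gaussianReal 0 (1 / 2)) :=
    (memLp_id_gaussianReal 2).ofReal
  exact (h.comp_fst _).add ((h.comp_snd _).mul_const Complex.I)

lemma integral_stdComplexGaussian : ∫ w, w ∂stdComplexGaussian = 0 := by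
  have h : Integrable (fun x : ℝ => (x : ℂ)) (gaussianReal 0 (1 / 2)) :=
    ((memLp_id_gaussianReal 2).integrable (by norm_num)).ofReal
  have h0 : ∫ x : ℝ, (x : ℂ) ∂(gaussianReal 0 (1 / 2)) = 0 := by
    rw [integral_complex_ofReal, integral_id_gaussianReal, Complex.ofReal_zero]
  rw [stdComplexGaussian, integral_map measurable_ofReal_add_mul_I.aemeasurable (by fun_prop),
    integral_add (h.comp_fst _) ((h.comp_snd _).mul_const Complex.I), integral_mul_const]
  rw [integral_fun_fst (fun x : ℝ => (x : ℂ)), integral_fun_snd (fun x : ℝ => (x : ℂ)), h0]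
  simp

lemma integral_sq_gaussianReal_half : ∫ x, x ^ 2 ∂(gaussianReal 0 (1 / 2)) = 1 / 2 := by
  have h := variance_fun_id_gaussianReal (μ := 0) (v := 1 / 2)
  rw [variance_of_integral_eq_zero (by fun_prop) (by simp)] at h
  rw [h]
  norm_num

lemma integral_norm_sq_stdComplexGaussian : ∫ w, ‖w‖ ^ 2 ∂stdComplexGaussian = 1 := by
  have h : Integrable (fun x : ℝ => x ^ 2) (gaussianReal 0 (1 / 2)) :=
    (memLp_id_gaussianReal 2).integrable_sq
  have h1 : ∀ p : ℝ × ℝ, ‖(p.1 : ℂ) + (p.2 : ℂ) * Complex.I‖ ^ 2 = p.1 ^ 2 + p.2 ^ 2 := by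
    intro p
    rw [← Complex.normSq_eq_norm_sq, Complex.normSq_apply]
    simp
    ring
  rw [stdComplexGaussian, integral_map measurable_ofReal_add_mul_I.aemeasurable (by fun_prop)]
  simp_rw [h1]
  rw [integral_add (h.comp_fst _) (h.comp_snd _), integral_fun_fst (fun x : ℝ => x ^ 2),
    integral_fun_snd (fun x : ℝ => x ^ 2), integral_sq_gaussianReal_half]
  norm_num

/-- Write `log = log⁺ ‖w‖ - log⁺ ‖w‖⁻¹`: the first part is dominated by `‖w‖`, the second is already
Lebesgue integrable. -/
lemma integrable_log_norm_stdComplexGaussian :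
    Integrable (fun w : ℂ => Real.log ‖w‖) stdComplexGaussian := by
  have h1 : Integrable (fun w : ℂ => Real.posLog ‖w‖⁻¹) stdComplexGaussian := by
    have := integrable_posLog_norm one_pos
    simp only [one_mul] at this
    exact this.mono_measure stdComplexGaussian_le_volume
  have h2 : Integrable (fun w : ℂ => Real.posLog ‖w‖) stdComplexGaussian := by
    refine Integrable.mono' (memLp_stdComplexGaussian.integrable (by norm_num)).norm
      (Real.continuous_posLog.comp continuous_norm).aestronglyMeasurable
      (Eventually.of_forall fun w => ?_)
    rw [Real.norm_of_nonneg Real.posLog_nonneg]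
    exact max_le (norm_nonneg _) ((Real.log_le_self (norm_nonneg _)))
  refine (h2.sub h1).congr (Eventually.of_forall fun w => ?_)
  exact Real.posLog_sub_posLog_inv

/-! ### Convergence and analyticity of the random series. -/

lemma hasSum_su11_choose {𝕜 : Type*} [RCLike 𝕜] {L : ℕ} (hL : 1 ≤ L) {z : 𝕜} (hz : ‖z‖ < 1) :
    HasSum (fun m : ℕ => ((m + L - 1).choose m : 𝕜) * z ^ m) (((1 - z) ^ L)⁻¹) := by
  obtain ⟨k, rfl⟩ := Nat.exists_eq_add_of_le' hL
  have := hasSum_choose_mul_geometric_of_norm_lt_one k hz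
  rw [one_div] at this
  refine this.congr_fun fun m => ?_
  rw [show m + (k + 1) - 1 = m + k by omega, Nat.choose_symm_add]

lemma sq_sqrt_su11_choose (L m : ℕ) :
    Real.sqrt ((m + L - 1).choose m : ℝ) ^ 2 = ((m + L - 1).choose m : ℝ) :=
  Real.sq_sqrt (Nat.cast_nonneg _)

lemma sqrt_natCast_le_self (n : ℕ) : Real.sqrt (n : ℝ) ≤ n := by
  rw [Real.sqrt_le_left (Nat.cast_nonneg _)]
  exact_mod_cast Nat.le_self_pow two_ne_zero n

lemma summable_sqrt_su11_choose {L : ℕ} (hL : 1 ≤ L) {r : ℝ} (h0 : 0 ≤ r) (h1 : r < 1) :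
    Summable fun m : ℕ => Real.sqrt ((m + L - 1).choose m : ℝ) * r ^ m := by
  refine Summable.of_nonneg_of_le (fun m => by positivity) (fun m => ?_)
    (hasSum_su11_choose (𝕜 := ℝ) hL (z := r) (by rwa [Real.norm_of_nonneg h0])).summable
  exact mul_le_mul_of_nonneg_right (sqrt_natCast_le_self _) (pow_nonneg h0 m)

lemma norm_su11Term (L : ℕ) (a : ℕ → ℂ) (z : ℂ) (m : ℕ) :
    ‖su11Term L a z m‖ = Real.sqrt ((m + L - 1).choose m : ℝ) * ‖z‖ ^ m * ‖a m‖ := by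
  rw [su11Term, norm_mul, norm_mul, norm_pow, Complex.norm_real,
    Real.norm_of_nonneg (Real.sqrt_nonneg _)]
  ring

lemma measurable_su11Term (L : ℕ) {Ω : Type*} [MeasurableSpace Ω] {a : ℕ → Ω → ℂ}
    (ha : ∀ m, Measurable (a m)) (m : ℕ) :
    Measurable fun p : Ω × ℂ => su11Term L (fun m => a m p.1) p.2 m :=
  (measurable_const.mul ((ha m).comp measurable_fst)).mul (measurable_snd.pow_const m)

lemma measurable_su11Function (L : ℕ) {Ω : Type*} [MeasurableSpace Ω] {a : ℕ → Ω → ℂ}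
    (ha : ∀ m, Measurable (a m)) :
    Measurable fun p : Ω × ℂ => su11Function L (fun m => a m p.1) p.2 :=
  Measurable.tsum fun m => measurable_su11Term L ha m

/-- The series with the given coefficients converges absolutely in the disk. -/
def SU11Summable (L : ℕ) (a : ℕ → ℂ) : Prop :=
  ∀ z ∈ Metric.ball (0 : ℂ) 1, Summable fun m => ‖su11Term L a z m‖

/-- On a disk of radius `r < 1` the terms are dominated by those at the real point `r`, so the
Weierstrass test applies. -/
lemma SU11Summable.analyticOnNhd {L : ℕ} {a : ℕ → ℂ} (h : SU11Summable L a) :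
    AnalyticOnNhd ℂ (su11Function L a) (Metric.ball 0 1) := by
  intro z hz
  rw [mem_ball_zero_iff] at hz
  obtain ⟨r, hzr, hr⟩ := exists_between hz
  have hr0 : 0 ≤ r := (norm_nonneg z).trans hzr.le
  have hd : DifferentiableOn ℂ (su11Function L a) (Metric.ball 0 r) := by
    refine Complex.differentiableOn_tsum_of_summable_norm
      (h (r : ℂ) (by simpa [abs_of_nonneg hr0] using hr)) (fun m => ?_) Metric.isOpen_ball
      fun m w hw => ?_
    · unfold su11Term
      fun_prop
    · rw [mem_ball_zero_iff] at hw
      rw [norm_su11Term, norm_su11Term, Complex.norm_real, Real.norm_of_nonneg hr0]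
      gcongr
  exact hd.analyticAt (Metric.isOpen_ball.mem_nhds (mem_ball_zero_iff.2 hzr))

section Random

variable {Ω : Type*} [MeasurableSpace Ω] {P : Measure Ω}
  {a : ℕ → Ω → ℂ}

lemma IsIIDStdComplexGaussian.memLp (ha : IsIIDStdComplexGaussian P a) (m : ℕ) :
    MemLp (a m) 2 P := by
  have h := memLp_stdComplexGaussian
  rw [← (ha.hasLaw m).map_eq, memLp_map_measure_iff (by fun_prop) (ha.hasLaw m).aemeasurable] at h
  exact h

lemma IsIIDStdComplexGaussian.integral_norm_sq (ha : IsIIDStdComplexGaussian P a) (m : ℕ) :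
    ∫ ω, ‖a m ω‖ ^ 2 ∂P = 1 := by
  rw [← integral_norm_sq_stdComplexGaussian, ← (ha.hasLaw m).integral_comp (by fun_prop)]
  rfl

/-- A bound uniform in `m` and `n`, from `2xy ≤ x² + y²`; it makes the double series for the
covariance absolutely summable in `L¹`. -/
lemma IsIIDStdComplexGaussian.integral_norm_mul_le (ha : IsIIDStdComplexGaussian P a) (m n : ℕ) :
    ∫ ω, ‖a m ω * conj (a n ω)‖ ∂P ≤ 1 := by
  have hi : ∀ m, Integrable (fun ω => ‖a m ω‖ ^ 2) P := fun m => (ha.memLp m).integrable_norm_pow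
    (by norm_num)
  calc ∫ ω, ‖a m ω * conj (a n ω)‖ ∂P
      ≤ ∫ ω, (‖a m ω‖ ^ 2 / 2 + ‖a n ω‖ ^ 2 / 2) ∂P := by
        refine integral_mono_of_nonneg (Eventually.of_forall fun _ => norm_nonneg _)
          (((hi m).div_const 2).add ((hi n).div_const 2)) (Eventually.of_forall fun ω => ?_)
        simp only [norm_mul, RCLike.norm_conj]
        nlinarith [sq_nonneg (‖a m ω‖ - ‖a n ω‖)]
    _ = 1 := by
        rw [integral_add ((hi m).div_const 2) ((hi n).div_const 2), integral_div, integral_div,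
          ha.integral_norm_sq, ha.integral_norm_sq]
        norm_num

lemma IsIIDStdComplexGaussian.integrable_mul_conj (ha : IsIIDStdComplexGaussian P a) (m n : ℕ) :
    Integrable (fun ω => a m ω * conj (a n ω)) P :=
  (ha.memLp m).integrable_mul (ha.memLp n).star

lemma IsIIDStdComplexGaussian.integral_mul_conj (ha : IsIIDStdComplexGaussian P a) (m n : ℕ) :
    ∫ ω, a m ω * conj (a n ω) ∂P = if m = n then 1 else 0 := by
  split_ifs with h
  · subst h
    simp_rw [Complex.mul_conj, Complex.normSq_eq_norm_sq]
    rw [integral_complex_ofReal, ha.integral_norm_sq, Complex.ofReal_one]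
  · rw [(ha.indep.indepFun h).integral_fun_comp_mul_comp (f := fun w => w) (g := fun w => conj w)
      (ha.hasLaw m).aemeasurable (ha.hasLaw n).aemeasurable (by fun_prop)
      (Complex.continuous_conj.aestronglyMeasurable)]
    have : ∫ ω, a m ω ∂P = 0 := by
      rw [(ha.hasLaw m).integral_eq, integral_stdComplexGaussian]
    rw [this, zero_mul]

/-- At a fixed radius the `L²` norms of the terms are summable, which gives almost sure absolute
convergence. The radii `1 - 1/(n+1)` yield one null set for all `z`, since the norm of each term
increases with `‖z‖`. -/
lemma IsIIDStdComplexGaussian.ae_su11Summable (ha : IsIIDStdComplexGaussian P a) {L : ℕ}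
    (hL : 1 ≤ L) : ∀ᵐ ω ∂P, SU11Summable L fun m => a m ω := by
  have hC : ∀ m, eLpNorm (a m) 2 P = eLpNorm (fun w : ℂ => w) 2 stdComplexGaussian := by
    intro m
    rw [← (ha.hasLaw m).map_eq, eLpNorm_map_measure (by fun_prop) (ha.hasLaw m).aemeasurable]
    rfl
  have key : ∀ r : ℝ, 0 ≤ r → r < 1 → ∀ᵐ ω ∂P,
      Summable fun m => ‖su11Term L (fun m => a m ω) (r : ℂ) m‖ := by
    intro r h0 h1
    refine summable_norm_of_tsum_eLpNorm_ne_top (p := 2) (by norm_num)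
      (f := fun m ω => su11Term L (fun m => a m ω) (r : ℂ) m) (fun m => ?_) ?_
    · exact (((ha.hasLaw m).aemeasurable.const_mul _).mul_const _).aestronglyMeasurable
    · have : ∀ m, eLpNorm (fun ω => su11Term L (fun m => a m ω) (r : ℂ) m) 2 P =
          ‖Real.sqrt ((m + L - 1).choose m : ℝ) * r ^ m‖ₑ *
            eLpNorm (fun w : ℂ => w) 2 stdComplexGaussian := by
        intro m
        rw [← hC m, ← eLpNorm_const_smul]
        congr 1
        ext ω
        simp only [su11Term, Pi.smul_apply, Complex.real_smul]
        push_cast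
        ring
      simp_rw [this]
      rw [ENNReal.tsum_mul_right]
      refine ENNReal.mul_ne_top ?_ memLp_stdComplexGaussian.eLpNorm_ne_top
      exact tsum_enorm_ne_top_iff_summable_norm.2 (summable_sqrt_su11_choose hL h0 h1).norm
  have hall : ∀ᵐ ω ∂P, ∀ n : ℕ,
      Summable fun m => ‖su11Term L (fun m => a m ω) ((1 - 1 / ((n : ℝ) + 1) : ℝ) : ℂ) m‖ := by
    refine ae_all_iff.2 fun n => key _ ?_ ?_
    · rw [sub_nonneg, div_le_one (by positivity)]
      linarith [(Nat.cast_nonneg n : (0 : ℝ) ≤ n)]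
    · have : 0 < 1 / ((n : ℝ) + 1) := by positivity
      linarith
  filter_upwards [hall] with ω h z hz
  rw [mem_ball_zero_iff] at hz
  obtain ⟨n, hn⟩ := exists_nat_one_div_lt (sub_pos.2 hz)
  refine (h n).of_nonneg_of_le (fun m => norm_nonneg _) fun m => ?_
  rw [norm_su11Term, norm_su11Term, Complex.norm_real]
  have : ‖z‖ ≤ ‖1 - 1 / ((n : ℝ) + 1)‖ := by
    refine le_trans ?_ (le_abs_self _)
    linarith
  gcongr

end Random

/-! ### Law of the values, covariance and logarithmic moment. -/

lemma inner_mul_left_eq_inner_conj_mul (b x t : ℂ) :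
    inner ℝ (b * x) t = inner ℝ x (conj b * t) := by
  simp only [Complex.inner, map_mul]
  ring_nf

/-- The characteristic function of `b • w` for a standard complex Gaussian `w`. -/
lemma charFun_map_const_mul_stdComplexGaussian (b t : ℂ) :
    charFun (stdComplexGaussian.map (b * ·)) t =
      Complex.exp (-((‖b‖ ^ 2 * (‖t‖ ^ 2 / 4) : ℝ) : ℂ)) := by
  rw [charFun_apply, integral_map (by fun_prop) (by fun_prop)]
  simp_rw [inner_mul_left_eq_inner_conj_mul]
  rw [← charFun_apply, charFun_stdComplexGaussian]
  congr 3
  rw [norm_mul, RCLike.norm_conj]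
  ring

lemma hasSum_norm_sq_su11 {L : ℕ} (hL : 1 ≤ L) {z : ℂ} (hz : ‖z‖ < 1) :
    HasSum (fun m : ℕ => ‖((Real.sqrt ((m + L - 1).choose m : ℝ) : ℂ)) * z ^ m‖ ^ 2)
      (((1 - ‖z‖ ^ 2) ^ L)⁻¹) := by
  have h : ‖‖z‖ ^ 2‖ < 1 := by
    rw [Real.norm_of_nonneg (by positivity)]
    exact pow_lt_one₀ (norm_nonneg z) hz two_ne_zero
  refine (hasSum_su11_choose (𝕜 := ℝ) hL h).congr_fun fun m => ?_
  rw [norm_mul, norm_pow, Complex.norm_real, Real.norm_of_nonneg (Real.sqrt_nonneg _), mul_pow,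
    sq_sqrt_su11_choose, ← pow_mul, ← pow_mul, mul_comm 2 m]

lemma ae_ne_zero_stdComplexGaussian : ∀ᵐ w ∂stdComplexGaussian, w ≠ 0 := by
  have : ∀ᵐ w : ℂ, w ≠ 0 := by simp [ae_iff]
  exact (Measure.absolutelyContinuous_of_le stdComplexGaussian_le_volume).ae_le this

section Random

variable {Ω : Type*} [MeasurableSpace Ω] {P : Measure Ω}
  {a : ℕ → Ω → ℂ}

lemma IsIIDStdComplexGaussian.charFun_map_sum_range (ha : IsIIDStdComplexGaussian P a)
    (b : ℕ → ℂ) (n : ℕ) (t : ℂ) :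
    charFun (P.map fun ω => ∑ m ∈ Finset.range n, b m * a m ω) t =
      Complex.exp (-(((∑ m ∈ Finset.range n, ‖b m‖ ^ 2) * (‖t‖ ^ 2 / 4) : ℝ) : ℂ)) := by
  have hind : iIndepFun (fun m ω => b m * a m ω) P :=
    ha.indep.comp (fun m w => b m * w) fun m => measurable_const_mul (b m)
  have hmap : ∀ m, P.map (fun ω => b m * a m ω) = stdComplexGaussian.map (b m * ·) := by
    intro m
    rw [← (ha.hasLaw m).map_eq, AEMeasurable.map_map_of_aemeasurable (by fun_prop)
      (ha.hasLaw m).aemeasurable]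
    rfl
  rw [iIndepFun.charFun_map_fun_finsetSum_eq_prod (X := fun m ω => b m * a m ω)
    (fun m _ => (ha.hasLaw m).aemeasurable.const_mul _) (hind.restrict _), Finset.prod_apply]
  simp_rw [hmap, charFun_map_const_mul_stdComplexGaussian]
  rw [← Complex.exp_sum]
  congr 1
  rw [Finset.sum_mul, Complex.ofReal_sum, Finset.sum_neg_distrib]

variable [IsProbabilityMeasure P]

/-- Each value of the random function is a scaled standard complex Gaussian. -/
lemma IsIIDStdComplexGaussian.hasLaw_su11Function (ha : IsIIDStdComplexGaussian P a)
    {L : ℕ} (hL : 1 ≤ L) {z : ℂ} (hz : ‖z‖ < 1) :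
    HasLaw (fun ω => su11Function L (fun m => a m ω) z)
      (stdComplexGaussian.map ((Real.sqrt (((1 - ‖z‖ ^ 2) ^ L)⁻¹) : ℂ) * ·)) P := by
  set b : ℕ → ℂ := fun m => (Real.sqrt ((m + L - 1).choose m : ℝ) : ℂ) * z ^ m
  have hterm : ∀ ω m, su11Term L (fun m => a m ω) z m = b m * a m ω := fun ω m => by
    simp only [su11Term, b]
    ring
  have hpm : ∀ n, AEMeasurable (fun ω => ∑ m ∈ Finset.range n, b m * a m ω) P := fun n =>
    Finset.aemeasurable_fun_sum _ fun m _ => (ha.hasLaw m).aemeasurable.const_mul _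
  have hlim : ∀ᵐ ω ∂P, Tendsto (fun n => ∑ m ∈ Finset.range n, b m * a m ω) atTop
      (𝓝 (su11Function L (fun m => a m ω) z)) := by
    filter_upwards [ha.ae_su11Summable hL] with ω hω
    simp_rw [← hterm]
    exact (hω z (mem_ball_zero_iff.2 hz)).of_norm.hasSum.tendsto_sum_nat
  have hm : AEMeasurable (fun ω => su11Function L (fun m => a m ω) z) P :=
    aemeasurable_of_tendsto_metrizable_ae _ hpm hlim
  refine ⟨hm, ?_⟩
  have := Measure.isProbabilityMeasure_map (μ := P) hm
  have : IsProbabilityMeasure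
      (stdComplexGaussian.map ((Real.sqrt (((1 - ‖z‖ ^ 2) ^ L)⁻¹) : ℂ) * ·)) :=
    Measure.isProbabilityMeasure_map (by fun_prop)
  -- The characteristic functions of the partial sums have two limits: that of the almost sure
  -- limit, by dominated convergence, and an explicit Gaussian one, by summing the variances.
  refine Measure.ext_of_charFun (funext fun t => ?_)
  have h1 : Tendsto (fun n => charFun (P.map fun ω => ∑ m ∈ Finset.range n, b m * a m ω) t) atTop
      (𝓝 (charFun (P.map fun ω => su11Function L (fun m => a m ω) z) t)) := by
    simp_rw [charFun_apply]
    rw [integral_map hm (by fun_prop)]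
    have : ∀ n, ∫ x, Complex.exp ((inner ℝ x t : ℝ) * Complex.I)
        ∂(P.map fun ω => ∑ m ∈ Finset.range n, b m * a m ω) =
        ∫ ω, Complex.exp ((inner ℝ (∑ m ∈ Finset.range n, b m * a m ω) t : ℝ) * Complex.I) ∂P :=
      fun n => integral_map (hpm n) (by fun_prop)
    simp_rw [this]
    refine tendsto_integral_of_dominated_convergence (fun _ => 1) (fun n => ?_)
      (integrable_const _) (fun n => Eventually.of_forall fun ω => ?_) ?_
    · exact ((by fun_prop : Continuous fun x : ℂ =>
        Complex.exp ((inner ℝ x t : ℝ) * Complex.I)).measurable.comp_aemeasurable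
          (hpm n)).aestronglyMeasurable
    · rw [Complex.norm_exp_ofReal_mul_I]
    · filter_upwards [hlim] with ω hω
      exact ((by fun_prop : Continuous fun x : ℂ =>
        Complex.exp ((inner ℝ x t : ℝ) * Complex.I)).tendsto _).comp hω
  have h2 : Tendsto (fun n => charFun (P.map fun ω => ∑ m ∈ Finset.range n, b m * a m ω) t) atTop
      (𝓝 (Complex.exp (-(((((1 - ‖z‖ ^ 2) ^ L)⁻¹) * (‖t‖ ^ 2 / 4) : ℝ) : ℂ)))) := by
    simp_rw [ha.charFun_map_sum_range]
    have hs := (hasSum_norm_sq_su11 hL hz).tendsto_sum_nat.mul_const (‖t‖ ^ 2 / 4)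
    exact ((Complex.continuous_exp.comp (Complex.continuous_ofReal.neg)).tendsto _).comp hs
  rw [tendsto_nhds_unique h1 h2, charFun_map_const_mul_stdComplexGaussian, Complex.norm_real,
    Real.norm_of_nonneg (Real.sqrt_nonneg _), Real.sq_sqrt]
  have : ‖z‖ ^ 2 < 1 := pow_lt_one₀ (norm_nonneg z) hz two_ne_zero
  exact inv_nonneg.2 (pow_nonneg (by linarith) _)

lemma IsIIDStdComplexGaussian.memLp_su11Function (ha : IsIIDStdComplexGaussian P a)
    {L : ℕ} (hL : 1 ≤ L) {z : ℂ} (hz : ‖z‖ < 1) :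
    MemLp (fun ω => su11Function L (fun m => a m ω) z) 2 P := by
  have hlaw := ha.hasLaw_su11Function hL hz
  have h : MemLp (fun w : ℂ => w) 2
      (stdComplexGaussian.map ((Real.sqrt (((1 - ‖z‖ ^ 2) ^ L)⁻¹) : ℂ) * ·)) := by
    rw [memLp_map_measure_iff (by fun_prop) (by fun_prop)]
    exact memLp_stdComplexGaussian.const_mul _
  rw [← hlaw.map_eq, memLp_map_measure_iff (by fun_prop) hlaw.aemeasurable] at h
  exact h

/-- The product is expanded into a double series and integrated termwise; orthonormality of the
coefficients leaves only the diagonal, a negative binomial series in `z * conj z'`. -/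
lemma IsIIDStdComplexGaussian.covariance_su11Function (ha : IsIIDStdComplexGaussian P a)
    {L : ℕ} (hL : 1 ≤ L) {z z' : ℂ} (hz : ‖z‖ < 1) (hz' : ‖z'‖ < 1) :
    Integrable (fun ω => su11Function L (fun m => a m ω) z *
      conj (su11Function L (fun m => a m ω) z')) P ∧
    ∫ ω, su11Function L (fun m => a m ω) z * conj (su11Function L (fun m => a m ω) z') ∂P =
      ((1 - z * conj z') ^ L)⁻¹ := by
  refine ⟨(ha.memLp_su11Function hL hz).integrable_mul (ha.memLp_su11Function hL hz').star, ?_⟩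
  set b : ℂ → ℕ → ℂ := fun z m => (Real.sqrt ((m + L - 1).choose m : ℝ) : ℂ) * z ^ m
  have hterm : ∀ z ω m, su11Term L (fun m => a m ω) z m = b z m * a m ω := fun z ω m => by
    simp only [su11Term, b]
    ring
  have hb : ∀ z : ℂ, ‖z‖ < 1 → Summable fun m => ‖b z m‖ := by
    intro z hz
    refine (summable_sqrt_su11_choose hL (norm_nonneg z) hz).congr fun m => ?_
    rw [norm_mul, norm_pow, Complex.norm_real, Real.norm_of_nonneg (Real.sqrt_nonneg _)]
  set F : ℕ × ℕ → Ω → ℂ := fun p ω =>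
    (b z p.1 * conj (b z' p.2)) * (a p.1 ω * conj (a p.2 ω))
  have hFi : ∀ p, Integrable (F p) P := fun p => (ha.integrable_mul_conj _ _).const_mul _
  have hFs : Summable fun p => ∫ ω, ‖F p ω‖ ∂P := by
    refine Summable.of_nonneg_of_le (fun p => integral_nonneg fun _ => norm_nonneg _)
      (fun p => ?_) ((hb z hz).mul_of_nonneg (hb z' hz') (fun _ => norm_nonneg _)
        (fun _ => norm_nonneg _))
    simp only [F, norm_mul (b z p.1 * _), integral_const_mul]
    rw [norm_mul, RCLike.norm_conj]
    exact mul_le_of_le_one_right (by positivity) (ha.integral_norm_mul_le _ _)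
  have hsum := hasSum_integral_of_summable_integral_norm hFi hFs
  have hprod : ∫ ω, su11Function L (fun m => a m ω) z *
      conj (su11Function L (fun m => a m ω) z') ∂P = ∫ ω, ∑' p, F p ω ∂P := by
    refine integral_congr_ae ?_
    filter_upwards [ha.ae_su11Summable hL] with ω hω
    have h1 := hω z (mem_ball_zero_iff.2 hz)
    have h2 := hω z' (mem_ball_zero_iff.2 hz')
    rw [su11Function, su11Function, Complex.conj_tsum,
      tsum_mul_tsum_of_summable_norm h1 (by simpa using h2)]
    refine tsum_congr fun p => ?_
    rw [hterm, hterm, map_mul]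
    ring
  have hFint : ∀ p : ℕ × ℕ, ∫ ω, F p ω ∂P =
      if p.1 = p.2 then b z p.1 * conj (b z' p.1) else 0 := by
    intro p
    simp only [F, integral_const_mul, ha.integral_mul_conj]
    split_ifs with h
    · rw [h, mul_one]
    · rw [mul_zero]
  simp_rw [hFint] at hsum
  have hinj : Function.Injective fun m : ℕ => (m, m) := fun m n h => congrArg Prod.fst h
  have hdiag : HasSum (fun m => b z m * conj (b z' m)) (∫ ω, ∑' p, F p ω ∂P) := by
    have := (hinj.hasSum_iff (f := fun p : ℕ × ℕ =>
      if p.1 = p.2 then b z p.1 * conj (b z' p.1) else 0) ?_).2 hsum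
    · simpa [Function.comp_def] using this
    · rintro ⟨m, n⟩ h
      rw [if_neg]
      intro hmn
      exact h ⟨m, congrArg (Prod.mk m) hmn⟩
  have hzz : ‖z * conj z'‖ < 1 := by
    rw [norm_mul, RCLike.norm_conj]
    exact mul_lt_one_of_nonneg_of_lt_one_left (norm_nonneg _) hz hz'.le
  rw [hprod]
  refine hdiag.unique ((hasSum_su11_choose hL hzz).congr_fun fun m => ?_)
  simp only [b, map_mul, map_pow, Complex.conj_ofReal, mul_pow]
  have : (Real.sqrt ((m + L - 1).choose m : ℝ) : ℂ) * (Real.sqrt ((m + L - 1).choose m : ℝ) : ℂ) =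
      ((m + L - 1).choose m : ℂ) := by
    rw [← Complex.ofReal_mul, Real.mul_self_sqrt (Nat.cast_nonneg _), Complex.ofReal_natCast]
  linear_combination (z ^ m * conj z' ^ m) * this

/-- The Gaussian law has no atom at `0`. Applied at `z = 0`, this excludes the zero function, whose
zeros would not be isolated. -/
lemma IsIIDStdComplexGaussian.ae_su11Function_ne_zero (ha : IsIIDStdComplexGaussian P a)
    {L : ℕ} (hL : 1 ≤ L) {z : ℂ} (hz : ‖z‖ < 1) :
    ∀ᵐ ω ∂P, su11Function L (fun m => a m ω) z ≠ 0 := by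
  have hlaw := ha.hasLaw_su11Function hL hz
  have hz2 : 0 < 1 - ‖z‖ ^ 2 := by
    have : ‖z‖ ^ 2 < 1 := pow_lt_one₀ (norm_nonneg z) hz two_ne_zero
    linarith
  have hσ : (Real.sqrt (((1 - ‖z‖ ^ 2) ^ L)⁻¹) : ℂ) ≠ 0 :=
    Complex.ofReal_ne_zero.2 (Real.sqrt_pos.2 (by positivity)).ne'
  refine ae_of_ae_map hlaw.aemeasurable (p := fun w => w ≠ 0) ?_
  rw [hlaw.map_eq, ae_map_iff (by fun_prop) (p := fun w => w ≠ 0) (measurableSet_singleton (0 : ℂ)).compl]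
  filter_upwards [ae_ne_zero_stdComplexGaussian] with w hw
  exact mul_ne_zero hσ hw

/-- The logarithmic moment of the values of the random function. -/
lemma IsIIDStdComplexGaussian.log_moment_su11Function (ha : IsIIDStdComplexGaussian P a)
    {L : ℕ} (hL : 1 ≤ L) {z : ℂ} (hz : ‖z‖ < 1) :
    Integrable (fun ω => Real.log ‖su11Function L (fun m => a m ω) z‖) P ∧
    ∫ ω, Real.log ‖su11Function L (fun m => a m ω) z‖ ∂P =
      ∫ w, Real.log ‖w‖ ∂stdComplexGaussian - L / 2 * Real.log (1 - ‖z‖ ^ 2) ∧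
    ∫ ω, |Real.log ‖su11Function L (fun m => a m ω) z‖| ∂P ≤
      ∫ w, |Real.log ‖w‖| ∂stdComplexGaussian + L / 2 * |Real.log (1 - ‖z‖ ^ 2)| := by
  have hlaw := ha.hasLaw_su11Function hL hz
  set σ : ℝ := Real.sqrt (((1 - ‖z‖ ^ 2) ^ L)⁻¹)
  have hz2 : 0 < 1 - ‖z‖ ^ 2 := by
    have : ‖z‖ ^ 2 < 1 := pow_lt_one₀ (norm_nonneg z) hz two_ne_zero
    linarith
  have hσ : 0 < σ := Real.sqrt_pos.2 (by positivity)
  have hlogσ : Real.log σ = -(L / 2 * Real.log (1 - ‖z‖ ^ 2)) := by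
    rw [Real.log_sqrt (by positivity), Real.log_inv, Real.log_pow]
    ring
  have hlogm : Measurable fun w : ℂ => Real.log ‖w‖ := by fun_prop
  have hI := integrable_log_norm_stdComplexGaussian
  have hlog : ∀ᵐ w ∂stdComplexGaussian,
      Real.log ‖(σ : ℂ) * w‖ = Real.log σ + Real.log ‖w‖ := by
    filter_upwards [ae_ne_zero_stdComplexGaussian] with w hw
    rw [norm_mul, Complex.norm_real, Real.norm_of_nonneg hσ.le,
      Real.log_mul hσ.ne' (norm_ne_zero_iff.2 hw)]
  refine ⟨?_, ?_, ?_⟩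
  · have h : Integrable (fun w : ℂ => Real.log ‖w‖) (stdComplexGaussian.map ((σ : ℂ) * ·)) := by
      rw [integrable_map_measure hlogm.aestronglyMeasurable (by fun_prop)]
      exact ((integrable_const _).add hI).congr (hlog.mono fun w h => h.symm)
    rw [← hlaw.map_eq, integrable_map_measure hlogm.aestronglyMeasurable hlaw.aemeasurable] at h
    exact h
  · have := hlaw.integral_comp (f := fun w => Real.log ‖w‖) hlogm.aestronglyMeasurable
    refine this.trans ?_
    rw [integral_map (by fun_prop) hlogm.aestronglyMeasurable, integral_congr_ae hlog,
      integral_add (integrable_const _) hI, hlogσ]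
    simp
    ring
  · have := hlaw.integral_comp (f := fun w => |Real.log ‖w‖|) hlogm.abs.aestronglyMeasurable
    refine this.trans_le ?_
    rw [integral_map (by fun_prop) hlogm.abs.aestronglyMeasurable]
    calc ∫ w, |Real.log ‖(σ : ℂ) * w‖| ∂stdComplexGaussian
        ≤ ∫ w, (|Real.log ‖w‖| + |Real.log σ|) ∂stdComplexGaussian := by
          refine integral_mono_of_nonneg (Eventually.of_forall fun _ => abs_nonneg _)
            (hI.abs.add (integrable_const _)) (hlog.mono fun w h => ?_)
          simp only [h]
          rw [add_comm]
          exact abs_add_le _ _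
      _ = _ := by
          rw [integral_add hI.abs (integrable_const _), hlogσ, abs_neg, abs_mul,
            abs_of_nonneg (by positivity : (0 : ℝ) ≤ L / 2)]
          simp

end Random

/-! ### Circle averages of `log (1 - |z|²)` and their limit. -/

/-- With `s = 1 - ‖c‖²` and `t = r²`, the exponential of the mean of `log (1 - ‖z‖²)` over the
circle of centre `c` and radius `r`. -/
noncomputable def diskLogMean (s t : ℝ) : ℝ :=
  ((s - t) + Real.sqrt ((s - t) ^ 2 - 4 * (1 - s) * t)) / 2

/-- `diskLogMean` is the larger root of `x² - (1 - ρ² - r²) x + ρ² r²`, whose discriminant is `(1 -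
(ρ + r)²)(1 - (ρ - r)²)`. The first bound is for dominated convergence, the second keeps the
auxiliary function of the next lemma zero-free. -/
lemma diskLogMean_spec {ρ r : ℝ} (hρ : 0 ≤ ρ) (hr : 0 < r) (h : ρ + r < 1) :
    (1 - (ρ + r) ^ 2) / 2 ≤ diskLogMean (1 - ρ ^ 2) (r ^ 2) ∧
    ρ * r < diskLogMean (1 - ρ ^ 2) (r ^ 2) ∧
    diskLogMean (1 - ρ ^ 2) (r ^ 2) ^ 2 + ρ ^ 2 * r ^ 2 =
      (1 - ρ ^ 2 - r ^ 2) * diskLogMean (1 - ρ ^ 2) (r ^ 2) := by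
  have h1 : 0 < 1 - (ρ + r) ^ 2 := by nlinarith
  have hD : 0 ≤ (1 - ρ ^ 2 - r ^ 2) ^ 2 - 4 * (1 - (1 - ρ ^ 2)) * r ^ 2 := by
    have : (1 - ρ ^ 2 - r ^ 2) ^ 2 - 4 * (1 - (1 - ρ ^ 2)) * r ^ 2 =
        (1 - (ρ + r) ^ 2) * (1 - (ρ + r) ^ 2 + 4 * (ρ * r)) := by ring
    rw [this]
    positivity
  have hs := Real.sq_sqrt hD
  have hs0 := Real.sqrt_nonneg ((1 - ρ ^ 2 - r ^ 2) ^ 2 - 4 * (1 - (1 - ρ ^ 2)) * r ^ 2)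
  have hρr : 0 ≤ ρ * r := by positivity
  unfold diskLogMean
  refine ⟨?_, ?_, ?_⟩
  · nlinarith
  · nlinarith
  · nlinarith

/-- On the circle, `1 - |z|²` coincides with `|g(z)|²` for the affine function `g(z) = √x - conj c
(z - c)/√x`; matching constant terms is the quadratic equation for `x`. As `|c| r < x`, `g` has no
zero in the closed disk, so `log|g|` has the mean value property and `g(c) = √x`. -/
lemma circleAverage_log_one_sub_norm_sq {c : ℂ} {r : ℝ} (hr : 0 < r) (h : ‖c‖ + r < 1) :
    Real.circleAverage (fun z => Real.log (1 - ‖z‖ ^ 2)) c r =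
      Real.log (diskLogMean (1 - ‖c‖ ^ 2) (r ^ 2)) := by
  obtain ⟨-, hx, hq⟩ := diskLogMean_spec (norm_nonneg c) hr h
  set x := diskLogMean (1 - ‖c‖ ^ 2) (r ^ 2)
  have hx0 : 0 < x := lt_of_le_of_lt (by positivity) hx
  have hsx : 0 < Real.sqrt x := Real.sqrt_pos.2 hx0
  set g : ℂ → ℂ := fun z => (Real.sqrt x : ℂ) - conj c * (z - c) / (Real.sqrt x : ℂ)
  have hβ : ∀ z, ‖conj c * (z - c) / (Real.sqrt x : ℂ)‖ = ‖c‖ * ‖z - c‖ / Real.sqrt x := by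
    intro z
    rw [norm_div, norm_mul, RCLike.norm_conj, Complex.norm_real, Real.norm_of_nonneg hsx.le]
  have hg0 : ∀ z ∈ Metric.closedBall c r, g z ≠ 0 := by
    intro z hz h0
    have h1 := congrArg norm (sub_eq_zero.1 h0)
    rw [hβ, Complex.norm_real, Real.norm_of_nonneg hsx.le, eq_div_iff hsx.ne',
      Real.mul_self_sqrt hx0.le] at h1
    rw [Metric.mem_closedBall, dist_eq_norm] at hz
    have := mul_le_mul_of_nonneg_left hz (norm_nonneg c)
    linarith
  have hgs : ∀ z ∈ Metric.sphere c |r|, Real.log (1 - ‖z‖ ^ 2) = 2 * Real.log ‖g z‖ := by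
    intro z hz
    rw [abs_of_pos hr, mem_sphere_iff_norm] at hz
    rw [← Real.log_rpow (norm_pos_iff.2 (hg0 z (by
      rw [Metric.mem_closedBall, dist_eq_norm, hz])))]
    congr 1
    rw [Real.rpow_two, ← Complex.normSq_eq_norm_sq (g z), Complex.normSq_sub,
      Complex.normSq_eq_norm_sq, Complex.normSq_eq_norm_sq, hβ, hz, Complex.norm_real,
      Real.norm_of_nonneg hsx.le, Real.sq_sqrt hx0.le, div_pow, Real.sq_sqrt hx0.le]
    have hre : ((Real.sqrt x : ℂ) * conj (conj c * (z - c) / (Real.sqrt x : ℂ))).re =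
        (conj c * (z - c)).re := by
      have : (Real.sqrt x : ℂ) ≠ 0 := Complex.ofReal_ne_zero.2 hsx.ne'
      rw [map_div₀, Complex.conj_ofReal, mul_div_cancel₀ _ this, Complex.conj_re]
    have hz2 : ‖z‖ ^ 2 = ‖c‖ ^ 2 + r ^ 2 + 2 * (conj c * (z - c)).re := by
      rw [← hz, ← Complex.normSq_eq_norm_sq, ← Complex.normSq_eq_norm_sq,
        ← Complex.normSq_eq_norm_sq]
      simp only [Complex.normSq_apply, Complex.mul_re, Complex.conj_re, Complex.conj_im,
        Complex.sub_re, Complex.sub_im]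
      ring
    rw [hre, hz2]
    have hq' : x + ‖c‖ ^ 2 * r ^ 2 / x = 1 - ‖c‖ ^ 2 - r ^ 2 := by
      rw [eq_comm, ← sub_eq_iff_eq_add', eq_div_iff hx0.ne']
      linarith
    rw [mul_pow]
    linarith
  have hga : AnalyticOnNhd ℂ g (Metric.closedBall c |r|) := fun z _ => by
    have : Differentiable ℂ g := by fun_prop
    exact this.analyticAt z
  have hlog := hga.circleAverage_log_norm_of_ne_zero (by rwa [abs_of_pos hr])
  rw [Real.circleAverage_congr_sphere hgs]
  have h2 : Real.circleAverage (fun z => 2 * Real.log ‖g z‖) c r =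
      2 * Real.circleAverage (fun z => Real.log ‖g z‖) c r :=
    Real.circleAverage_fun_smul (a := (2 : ℝ)) (f := fun z => Real.log ‖g z‖)
  rw [h2, hlog]
  have : g c = (Real.sqrt x : ℂ) := by simp [g]
  rw [this, Complex.norm_real, Real.norm_of_nonneg hsx.le, Real.log_sqrt hx0.le]
  ring

/-- With `s = 1 - ρ²` and `x` the root, the quadratic gives `s - x = r² (x + ρ²)/x`; insert it in `1
- 1/t ≤ log t ≤ t - 1` at `t = s/x`. As `r → 0`, `x → s` and both bounds tend to `1/s²`. -/
lemma log_sub_log_diskLogMean {ρ r : ℝ} (hρ : 0 ≤ ρ) (hr : 0 < r) (h : ρ + r < 1) :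
    (diskLogMean (1 - ρ ^ 2) (r ^ 2) + ρ ^ 2) /
        (diskLogMean (1 - ρ ^ 2) (r ^ 2) * (1 - ρ ^ 2)) ≤
      (Real.log (1 - ρ ^ 2) - Real.log (diskLogMean (1 - ρ ^ 2) (r ^ 2))) / r ^ 2 ∧
    (Real.log (1 - ρ ^ 2) - Real.log (diskLogMean (1 - ρ ^ 2) (r ^ 2))) / r ^ 2 ≤
      (diskLogMean (1 - ρ ^ 2) (r ^ 2) + ρ ^ 2) / diskLogMean (1 - ρ ^ 2) (r ^ 2) ^ 2 ∧
    diskLogMean (1 - ρ ^ 2) (r ^ 2) ≤ 1 - ρ ^ 2 := by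
  obtain ⟨-, hx, hq⟩ := diskLogMean_spec hρ hr h
  set x := diskLogMean (1 - ρ ^ 2) (r ^ 2)
  have hx0 : 0 < x := lt_of_le_of_lt (by positivity) hx
  have hs : 0 < 1 - ρ ^ 2 := by nlinarith
  have hr2 : 0 < r ^ 2 := by positivity
  have hdiff : 1 - ρ ^ 2 - x = r ^ 2 * ((x + ρ ^ 2) / x) := by
    field_simp
    linarith
  have h1 := Real.log_le_sub_one_of_pos (div_pos hs hx0)
  have h2 := Real.one_sub_inv_le_log_of_pos (div_pos hs hx0)
  rw [Real.log_div hs.ne' hx0.ne'] at h1 h2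
  refine ⟨?_, ?_, ?_⟩
  · rw [le_div_iff₀ hr2]
    refine le_trans (le_of_eq ?_) h2
    have : 1 - ((1 - ρ ^ 2) / x)⁻¹ = (1 - ρ ^ 2 - x) / (1 - ρ ^ 2) := by
      field_simp
    rw [this, hdiff]
    field_simp
  · rw [div_le_iff₀ hr2]
    refine h1.trans (le_of_eq ?_)
    have : (1 - ρ ^ 2) / x - 1 = (1 - ρ ^ 2 - x) / x := by
      field_simp
    rw [this, hdiff]
    field_simp
  · have : 0 ≤ r ^ 2 * ((x + ρ ^ 2) / x) := by positivity
    linarith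

lemma tendsto_log_sub_log_diskLogMean {ρ : ℝ} (hρ : 0 ≤ ρ) (hρ1 : ρ < 1) :
    Tendsto (fun r : ℝ =>
      (Real.log (1 - ρ ^ 2) - Real.log (diskLogMean (1 - ρ ^ 2) (r ^ 2))) / r ^ 2)
      (𝓝[>] 0) (𝓝 (((1 - ρ ^ 2) ^ 2)⁻¹)) := by
  have hs : 0 < 1 - ρ ^ 2 := by nlinarith
  have hx : Tendsto (fun r : ℝ => diskLogMean (1 - ρ ^ 2) (r ^ 2)) (𝓝[>] 0)
      (𝓝 (1 - ρ ^ 2)) := by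
    have hc : Continuous fun r : ℝ => diskLogMean (1 - ρ ^ 2) (r ^ 2) := by
      unfold diskLogMean
      fun_prop
    have h0 : diskLogMean (1 - ρ ^ 2) (0 ^ 2) = 1 - ρ ^ 2 := by
      simp [diskLogMean, Real.sqrt_sq hs.le]
    have := hc.tendsto 0
    rw [h0] at this
    exact this.mono_left nhdsWithin_le_nhds
  have hlow : Tendsto (fun r : ℝ => (diskLogMean (1 - ρ ^ 2) (r ^ 2) + ρ ^ 2) /
      (diskLogMean (1 - ρ ^ 2) (r ^ 2) * (1 - ρ ^ 2))) (𝓝[>] 0)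
      (𝓝 (((1 - ρ ^ 2) ^ 2)⁻¹)) := by
    have := (hx.add_const (ρ ^ 2)).div (hx.mul_const (1 - ρ ^ 2)) (by positivity)
    rw [sub_add_cancel, ← sq, one_div] at this
    exact this
  have hup : Tendsto (fun r : ℝ => (diskLogMean (1 - ρ ^ 2) (r ^ 2) + ρ ^ 2) /
      diskLogMean (1 - ρ ^ 2) (r ^ 2) ^ 2) (𝓝[>] 0) (𝓝 (((1 - ρ ^ 2) ^ 2)⁻¹)) := by
    have := (hx.add_const (ρ ^ 2)).div (hx.pow 2) (by positivity)
    rw [sub_add_cancel, one_div] at this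
    exact this
  refine tendsto_of_tendsto_of_tendsto_of_le_of_le' hlow hup ?_ ?_
  · filter_upwards [Ioo_mem_nhdsGT (sub_pos.2 hρ1)] with r hr
    exact (log_sub_log_diskLogMean hρ hr.1 (by linarith [hr.2])).1
  · filter_upwards [Ioo_mem_nhdsGT (sub_pos.2 hρ1)] with r hr
    exact (log_sub_log_diskLogMean hρ hr.1 (by linarith [hr.2])).2.1

/-- Locality is needed because the formula for the mean of `log|ψ|` is available only inside the
unit disk. -/
lemma smoothedLaplacian_congr {u v : ℂ → ℝ} {R R' r : ℝ} (hr : 0 < r) (hR : R + r ≤ R')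
    (huv : ∀ z ∈ Metric.closedBall (0 : ℂ) R', u z = v z) {φ : ℂ → ℂ}
    (hφ : ∀ z, z ∉ Metric.closedBall 0 R → φ z = 0) :
    smoothedLaplacian u r φ = smoothedLaplacian v r φ := by
  refine integral_congr_ae (Eventually.of_forall fun c => ?_)
  by_cases hc : c ∈ Metric.closedBall 0 R
  · have hsub : Metric.closedBall c r ⊆ Metric.closedBall 0 R' :=
      Metric.closedBall_subset_closedBall' (by
        have := Metric.mem_closedBall.1 hc
        linarith)
    have h1 : Real.circleAverage u c r = Real.circleAverage v c r :=
      Real.circleAverage_congr_sphere fun z hz =>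
        huv z (hsub (Metric.sphere_subset_closedBall (by rwa [abs_of_pos hr] at hz)))
    simp only [h1, huv c (hsub (Metric.mem_closedBall_self hr.le))]
  · simp only [hφ c hc, zero_mul]

/-- The smoothed Laplacians of `C - L/2 log (1 - ‖z‖²)` converge. -/
lemma tendsto_smoothedLaplacian_log (C : ℝ) (L : ℕ) {R M : ℝ} (hR0 : 0 ≤ R) (hR : R < 1)
    {φ : ℂ → ℂ} (hφm : Measurable φ) (hφM : ∀ z, ‖φ z‖ ≤ M)
    (hφ : ∀ z, z ∉ Metric.closedBall 0 R → φ z = 0) :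
    Tendsto (fun r => smoothedLaplacian (fun z => C - L / 2 * Real.log (1 - ‖z‖ ^ 2)) r φ)
      (𝓝[>] 0) (𝓝 (∫ z, φ z * ((L / (Real.pi * (1 - ‖z‖ ^ 2) ^ 2) : ℝ) : ℂ))) := by
  set q : ℝ → ℂ → ℝ := fun r c =>
    (Real.log (1 - ‖c‖ ^ 2) - Real.log (diskLogMean (1 - ‖c‖ ^ 2) (r ^ 2))) / r ^ 2
  have hM : 0 ≤ M := (norm_nonneg _).trans (hφM 0)
  have heq : ∀ r, 0 < r → R + r < 1 →
      smoothedLaplacian (fun z => C - L / 2 * Real.log (1 - ‖z‖ ^ 2)) r φ =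
        ∫ c, φ c * ((L / Real.pi * q r c : ℝ) : ℂ) := by
    intro r hr hRr
    refine integral_congr_ae (Eventually.of_forall fun c => ?_)
    by_cases hc : c ∈ Metric.closedBall 0 R
    · rw [mem_closedBall_zero_iff] at hc
      have hcr : ‖c‖ + r < 1 := by linarith
      have hci : CircleIntegrable (fun z => Real.log (1 - ‖z‖ ^ 2)) c r := by
        refine ContinuousOn.circleIntegrable hr.le fun z hz => ?_
        refine ContinuousAt.continuousWithinAt ?_
        refine ContinuousAt.log (by fun_prop) ?_
        rw [mem_sphere_iff_norm] at hz
        have : ‖z‖ < 1 := by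
          have := norm_add_le (z - c) c
          rw [sub_add_cancel] at this
          linarith
        have : ‖z‖ ^ 2 < 1 := pow_lt_one₀ (norm_nonneg z) this two_ne_zero
        linarith
      have havg : Real.circleAverage (fun z => C - L / 2 * Real.log (1 - ‖z‖ ^ 2)) c r =
          C - L / 2 * Real.log (diskLogMean (1 - ‖c‖ ^ 2) (r ^ 2)) := by
        rw [← circleAverage_log_one_sub_norm_sq hr hcr]
        have h1 := Real.circleAverage_fun_sub (circleIntegrable_const C c r)
          (hci.const_fun_smul (a := (L / 2 : ℝ)))
        have h2 := Real.circleAverage_fun_smul (a := (L / 2 : ℝ))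
          (f := fun z : ℂ => Real.log (1 - ‖z‖ ^ 2)) (c := c) (R := r)
        simp only [smul_eq_mul] at h1 h2
        rw [h1, h2, Real.circleAverage_const]
      simp only [havg, q]
      congr 2
      have := Real.pi_pos
      field_simp
      ring
    · simp only [hφ c hc, zero_mul]
  -- Any `R'` strictly between `R` and `1` would do. For `‖c‖ + r ≤ R'` the root `x` is at least `(1
  -- - R'²)/2` and `x + ‖c‖² ≤ 1`, so `K` bounds the difference quotients uniformly.
  set R' := (R + 1) / 2
  have hR' : R' < 1 := by simp only [R']; linarith
  set K := 4 / (1 - R' ^ 2) ^ 2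
  have hbound : ∀ r, 0 < r → R + r ≤ R' → ∀ c, ‖φ c * ((L / Real.pi * q r c : ℝ) : ℂ)‖ ≤
      (Metric.closedBall (0 : ℂ) R).indicator (fun _ => M * (L / Real.pi * K)) c := by
    intro r hr hRr c
    by_cases hc : c ∈ Metric.closedBall 0 R
    · rw [Set.indicator_of_mem hc]
      rw [mem_closedBall_zero_iff] at hc
      have hcr : ‖c‖ + r < 1 := by linarith
      obtain ⟨h1, h2, h3⟩ := log_sub_log_diskLogMean (norm_nonneg c) hr hcr
      obtain ⟨h4, h5, -⟩ := diskLogMean_spec (norm_nonneg c) hr hcr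
      set x := diskLogMean (1 - ‖c‖ ^ 2) (r ^ 2)
      have hx0 : 0 < x := lt_of_le_of_lt (by positivity) h5
      have hs : 0 < 1 - ‖c‖ ^ 2 := hx0.trans_le h3
      have hR'2 : (‖c‖ + r) ^ 2 ≤ R' ^ 2 := by gcongr; linarith
      have hR'1 : R' ^ 2 < 1 := pow_lt_one₀ (by simp only [R']; linarith) hR' two_ne_zero
      have hq0 : 0 ≤ q r c := le_trans (by positivity) h1
      have hqK : q r c ≤ K := by
        refine h2.trans ?_
        have hxl : (1 - R' ^ 2) / 2 ≤ x := by linarith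
        have hpos : 0 < (1 - R' ^ 2) / 2 := by linarith
        calc (x + ‖c‖ ^ 2) / x ^ 2 ≤ 1 / ((1 - R' ^ 2) / 2) ^ 2 := by
              gcongr
              linarith
          _ = K := by
              simp only [K]
              field_simp
              norm_num
      rw [norm_mul, Complex.norm_real, Real.norm_of_nonneg (by positivity)]
      have := Real.pi_pos
      gcongr
      exact hφM c
    · rw [Set.indicator_of_notMem hc, hφ c hc, zero_mul, norm_zero]
  have hlim : Tendsto (fun r => ∫ c, φ c * ((L / Real.pi * q r c : ℝ) : ℂ)) (𝓝[>] 0)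
      (𝓝 (∫ z, φ z * ((L / (Real.pi * (1 - ‖z‖ ^ 2) ^ 2) : ℝ) : ℂ))) := by
    refine tendsto_integral_filter_of_dominated_convergence
      ((Metric.closedBall (0 : ℂ) R).indicator fun _ => M * (L / Real.pi * K)) ?_ ?_ ?_ ?_
    · refine Eventually.of_forall fun r => Measurable.aestronglyMeasurable ?_
      simp only [q, diskLogMean]
      fun_prop
    · have : 0 < R' - R := by simp only [R']; linarith
      filter_upwards [Ioo_mem_nhdsGT this] with r hr
      exact Eventually.of_forall (hbound r hr.1 (by linarith [hr.2]))
    · rw [integrable_indicator_iff Metric.isClosed_closedBall.measurableSet]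
      exact integrableOn_const measure_closedBall_lt_top.ne
    · refine Eventually.of_forall fun c => ?_
      by_cases hc : c ∈ Metric.closedBall 0 R
      · rw [mem_closedBall_zero_iff] at hc
        have h1 := (tendsto_log_sub_log_diskLogMean (norm_nonneg c)
          (hc.trans_lt hR)).const_mul (L / Real.pi : ℝ)
        have h2 : (L / Real.pi * ((1 - ‖c‖ ^ 2) ^ 2)⁻¹ : ℝ) =
            L / (Real.pi * (1 - ‖c‖ ^ 2) ^ 2) := by
          rw [← div_div, div_eq_mul_inv (_ / _)]
        rw [h2] at h1
        exact ((Complex.continuous_ofReal.tendsto _).comp h1).const_mul _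
      · simp only [hφ c hc, zero_mul]
        exact tendsto_const_nhds
  refine hlim.congr' ?_
  filter_upwards [Ioo_mem_nhdsGT (sub_pos.2 hR)] with r hr
  exact (heq r hr.1 (by linarith [hr.2])).symm

/-! ### Expected linear statistics of the zeros. -/

lemma HasCompactSupport.exists_eq_zero_off_closedBall {φ : ℂ → ℂ} (hφ : HasCompactSupport φ)
    (hU : tsupport φ ⊆ Metric.ball 0 1) :
    ∃ R : ℝ, 0 ≤ R ∧ R < 1 ∧ ∀ z, z ∉ Metric.closedBall 0 R → φ z = 0 := by
  rcases (tsupport φ).eq_empty_or_nonempty with h | h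
  · refine ⟨0, le_rfl, one_pos, fun z _ => image_eq_zero_of_notMem_tsupport ?_⟩
    simp [h]
  · obtain ⟨w, hw, hmax⟩ := hφ.isCompact.exists_isMaxOn h continuous_norm.continuousOn
    refine ⟨‖w‖, norm_nonneg w, mem_ball_zero_iff.1 (hU hw), fun z hz => ?_⟩
    exact image_eq_zero_of_notMem_tsupport fun h => hz (mem_closedBall_zero_iff.2 (hmax h))

section Random

variable {Ω : Type*} [MeasurableSpace Ω] {P : Measure Ω} [IsProbabilityMeasure P]
  {a : ℕ → Ω → ℂ}

/-- The expectation of smoothed linear statistics of the zeros. -/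
lemma IsIIDStdComplexGaussian.integral_smoothedZeroSum (ha : IsIIDStdComplexGaussian P a)
    (ham : ∀ m, Measurable (a m)) {L : ℕ} (hL : 1 ≤ L) {R R' r M : ℝ} (hr : 0 < r)
    (hR : R + r ≤ R') (hR' : R' < 1) {φ : ℂ → ℂ} (hφm : Measurable φ) (hφM : ∀ z, ‖φ z‖ ≤ M)
    (hφ : ∀ z, z ∉ Metric.closedBall 0 R → φ z = 0) :
    Integrable (fun ω => smoothedZeroSum (su11Function L fun m => a m ω) r φ) P ∧
    ∫ ω, smoothedZeroSum (su11Function L fun m => a m ω) r φ ∂P =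
      smoothedLaplacian (fun z => ∫ w, Real.log ‖w‖ ∂stdComplexGaussian -
        L / 2 * Real.log (1 - ‖z‖ ^ 2)) r φ := by
  have hz1 : ∀ z ∈ Metric.closedBall (0 : ℂ) R', ‖z‖ < 1 := fun z hz =>
    (mem_closedBall_zero_iff.1 hz).trans_lt hR'
  have hmeas : Measurable (Function.uncurry fun (ω : Ω) (z : ℂ) =>
      Real.log ‖su11Function L (fun m => a m ω) z‖) :=
    Real.measurable_log.comp (measurable_su11Function L ham).norm
  have hB : ∀ z ∈ Metric.closedBall (0 : ℂ) R',
      ∫ ω, |Real.log ‖su11Function L (fun m => a m ω) z‖| ∂P ≤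
        ∫ w, |Real.log ‖w‖| ∂stdComplexGaussian + L / 2 * |Real.log (1 - R' ^ 2)| := by
    intro z hz
    refine (ha.log_moment_su11Function hL (hz1 z hz)).2.2.trans ?_
    have hzR := mem_closedBall_zero_iff.1 hz
    have hsq : ‖z‖ ^ 2 ≤ R' ^ 2 := pow_le_pow_left₀ (norm_nonneg z) hzR 2
    have hR1 : R' ^ 2 < 1 := pow_lt_one₀ ((norm_nonneg z).trans hzR) hR' two_ne_zero
    have h1 : Real.log (1 - R' ^ 2) ≤ Real.log (1 - ‖z‖ ^ 2) :=
      Real.log_le_log (by linarith) (by linarith)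
    have h2 : Real.log (1 - ‖z‖ ^ 2) ≤ 0 :=
      Real.log_nonpos (by linarith) (by linarith [sq_nonneg ‖z‖])
    rw [abs_of_nonpos h2, abs_of_nonpos (h1.trans h2)]
    gcongr
  obtain ⟨hi, he⟩ := integral_smoothedLaplacian (P := P) hmeas hr hR
    (fun z hz => (ha.log_moment_su11Function hL (hz1 z hz)).1) hB hφm hφM hφ
  refine ⟨hi, he.trans (smoothedLaplacian_congr hr hR (fun z hz => ?_) hφ)⟩
  exact (ha.log_moment_su11Function hL (hz1 z hz)).2.1

lemma IsIIDStdComplexGaussian.ae_analyticOnNhd_su11Function (ha : IsIIDStdComplexGaussian P a)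
    {L : ℕ} (hL : 1 ≤ L) :
    ∀ᵐ ω ∂P, AnalyticOnNhd ℂ (su11Function L fun m => a m ω) (Metric.ball 0 1) ∧
      ∃ z ∈ Metric.ball (0 : ℂ) 1, su11Function L (fun m => a m ω) z ≠ 0 := by
  filter_upwards [ha.ae_su11Summable hL,
    ha.ae_su11Function_ne_zero hL (z := 0) (by simp)] with ω h1 h2
  exact ⟨h1.analyticOnNhd, 0, by simp, h2⟩

/-- Dominated convergence along scales `ε n → 0`, the dominating function being `M` times the norm
of the smoothed count at the fixed scale `δ`. Measurability of the linear statistic also comes from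
its being an almost sure limit of smoothed ones. -/
lemma IsIIDStdComplexGaussian.integral_zeroSum_of_measurable (ha : IsIIDStdComplexGaussian P a)
    (ham : ∀ m, Measurable (a m)) {L : ℕ} (hL : 1 ≤ L) {R : ℝ} (hR0 : 0 ≤ R) (hR : R < 1)
    {φ : ℂ → ℂ} (hφc : Continuous φ) (hφ : ∀ z, z ∉ Metric.closedBall 0 R → φ z = 0) :
    Integrable (fun ω => zeroSum (su11Function L fun m => a m ω) (Metric.ball 0 1) φ) P ∧
    ∫ ω, zeroSum (su11Function L fun m => a m ω) (Metric.ball 0 1) φ ∂P =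
      ∫ z, φ z * ((L / (Real.pi * (1 - ‖z‖ ^ 2) ^ 2) : ℝ) : ℂ) := by
  obtain ⟨M, hM⟩ := hφc.bounded_above_of_compact_support
    (HasCompactSupport.intro (isCompact_closedBall 0 R) hφ)
  set ψ : Ω → ℂ → ℂ := fun ω => su11Function L fun m => a m ω
  -- A quarter of the gap, so that `R + 3δ < 1` as the domination estimate requires.
  set δ := (1 - R) / 4
  have hδ : 0 < δ := by simp only [δ]; linarith
  have hR' : R + 3 * δ < 1 := by simp only [δ]; linarith
  have hball : ∀ {ρ : ℝ}, ρ < 1 → Metric.closedBall (0 : ℂ) ρ ⊆ Metric.ball 0 1 := fun h =>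
    Metric.closedBall_subset_ball h
  have hpre : IsPreconnected (Metric.ball (0 : ℂ) 1) := (convex_ball 0 1).isPreconnected
  set χ : ℂ → ℂ := (Metric.closedBall 0 (R + 2 * δ)).indicator fun _ => 1
  have hχm : Measurable χ := measurable_const.indicator Metric.isClosed_closedBall.measurableSet
  have hχM : ∀ z, ‖χ z‖ ≤ 1 := fun z => by
    by_cases h : z ∈ Metric.closedBall (0 : ℂ) (R + 2 * δ) <;> simp [χ, h]
  have hχi : Integrable (fun ω => smoothedZeroSum (ψ ω) δ χ) P :=
    (ha.integral_smoothedZeroSum ham hL hδ (by linarith) hR' hχm hχM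
      fun z hz => Set.indicator_of_notMem hz _).1
  set ε : ℕ → ℝ := fun n => δ * (1 / ((n : ℝ) + 1))
  have hε0 : ∀ n, 0 < ε n := fun n => by positivity
  have hεδ : ∀ n, ε n ≤ δ := fun n => by
    refine mul_le_of_le_one_right hδ.le ?_
    rw [div_le_one (by positivity)]
    linarith [(Nat.cast_nonneg n : (0 : ℝ) ≤ n)]
  have hε : Tendsto ε atTop (𝓝[>] 0) := by
    refine tendsto_nhdsWithin_iff.2 ⟨?_, Eventually.of_forall hε0⟩
    simpa only [mul_zero] using tendsto_one_div_add_atTop_nhds_zero_nat.const_mul δ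
  have hE := fun n => ha.integral_smoothedZeroSum ham hL (hε0 n)
    (by linarith [hεδ n] : R + ε n ≤ R + 3 * δ) hR' hφc.measurable hM hφ
  have hlim : ∀ᵐ ω ∂P, Tendsto (fun n => smoothedZeroSum (ψ ω) (ε n) φ) atTop
      (𝓝 (zeroSum (ψ ω) (Metric.ball 0 1) φ)) := by
    filter_upwards [ha.ae_analyticOnNhd_su11Function hL] with ω hω
    exact (tendsto_smoothedZeroSum hω.1 hpre hω.2 (by linarith : R < R + 3 * δ) (hball hR')
      hφc hφ).comp hε
  have hdom : ∀ n, ∀ᵐ ω ∂P,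
      ‖smoothedZeroSum (ψ ω) (ε n) φ‖ ≤ M * ‖smoothedZeroSum (ψ ω) δ χ‖ := by
    intro n
    filter_upwards [ha.ae_analyticOnNhd_su11Function hL] with ω hω
    exact norm_smoothedZeroSum_le hω.1 hpre hω.2 (hε0 n) (hεδ n) (hball hR') hφc.measurable hM hφ
  have hint : Integrable (fun ω => M * ‖smoothedZeroSum (ψ ω) δ χ‖) P := hχi.norm.const_mul M
  have hmeas : AEStronglyMeasurable (fun ω => zeroSum (ψ ω) (Metric.ball 0 1) φ) P :=
    aestronglyMeasurable_of_tendsto_ae atTop (fun n => (hE n).1.aestronglyMeasurable) hlim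
  refine ⟨hint.mono' hmeas ?_, ?_⟩
  · filter_upwards [hlim, ae_all_iff.2 hdom] with ω h1 h2
    exact le_of_tendsto h1.norm (Eventually.of_forall h2)
  · have h1 := tendsto_integral_of_dominated_convergence _
      (fun n => (hE n).1.aestronglyMeasurable) hint hdom hlim
    refine tendsto_nhds_unique h1 ?_
    simp_rw [fun n => (hE n).2]
    exact (tendsto_smoothedLaplacian_log _ L hR0 hR hφc.measurable hM hφ).comp hε

lemma IsIIDStdComplexGaussian.integral_zeroSum (ha : IsIIDStdComplexGaussian P a)
    {L : ℕ} (hL : 1 ≤ L) {φ : ℂ → ℂ} (hφc : Continuous φ) (hφs : HasCompactSupport φ)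
    (hφ : tsupport φ ⊆ Metric.ball 0 1) :
    Integrable (fun ω => zeroSum (su11Function L fun m => a m ω) (Metric.ball 0 1) φ) P ∧
    ∫ ω, zeroSum (su11Function L fun m => a m ω) (Metric.ball 0 1) φ ∂P =
      ∫ z in Metric.ball (0 : ℂ) 1, ((L / (Real.pi * (1 - ‖z‖ ^ 2) ^ 2) : ℝ) : ℂ) * φ z := by
  obtain ⟨R, hR0, hR, hφR⟩ := hφs.exists_eq_zero_off_closedBall hφ
  -- Joint measurability in `(ω, z)` needs measurable coefficients, while `HasLaw` gives only almost
  -- everywhere measurability; countably many modifications change nothing almost surely.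
  set a' : ℕ → Ω → ℂ := fun m => (ha.hasLaw m).aemeasurable.mk
  have haa' : ∀ m, a m =ᵐ[P] a' m := fun m => (ha.hasLaw m).aemeasurable.ae_eq_mk
  have ha' : IsIIDStdComplexGaussian P a' :=
    ⟨fun m => (ha.hasLaw m).congr (haa' m).symm, (iIndepFun_congr haa').1 ha.indep⟩
  have heq : (fun ω => zeroSum (su11Function L fun m => a' m ω) (Metric.ball 0 1) φ) =ᵐ[P]
      fun ω => zeroSum (su11Function L fun m => a m ω) (Metric.ball 0 1) φ := by
    filter_upwards [ae_all_iff.2 haa'] with ω hω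
    simp only [hω]
  obtain ⟨h1, h2⟩ := ha'.integral_zeroSum_of_measurable
    (fun m => (ha.hasLaw m).aemeasurable.measurable_mk) hL hR0 hR hφc hφR
  refine ⟨h1.congr heq, ?_⟩
  rw [← integral_congr_ae heq, h2, setIntegral_eq_integral_of_forall_compl_eq_zero]
  · simp_rw [mul_comm]
  · intro z hz
    rw [image_eq_zero_of_notMem_tsupport fun h => hz (hφ h), mul_zero]

lemma locallyIntegrableOn_su11Density (L : ℕ) :
    LocallyIntegrableOn (fun z : ℂ => (L : ℝ) / (Real.pi * (1 - ‖z‖ ^ 2) ^ 2))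
      (Metric.ball 0 1) volume := by
  refine ContinuousOn.locallyIntegrableOn (fun z hz => ?_) Metric.isOpen_ball.measurableSet
  rw [mem_ball_zero_iff] at hz
  have : ‖z‖ ^ 2 < 1 := pow_lt_one₀ (norm_nonneg z) hz two_ne_zero
  have h : Real.pi * (1 - ‖z‖ ^ 2) ^ 2 ≠ 0 :=
    mul_ne_zero Real.pi_ne_zero (pow_ne_zero 2 (by linarith))
  exact ContinuousAt.continuousWithinAt (ContinuousAt.div (by fun_prop) (by fun_prop) h)

lemma IsIIDStdComplexGaussian.isZeroDensity (ha : IsIIDStdComplexGaussian P a)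
    {L : ℕ} (hL : 1 ≤ L) :
    IsZeroDensity P (fun ω => su11Function L (fun m => a m ω)) (Metric.ball (0 : ℂ) 1)
      (fun z => (L : ℝ) / (Real.pi * (1 - ‖z‖ ^ 2) ^ 2)) where
  analytic := (ha.ae_analyticOnNhd_su11Function hL).mono fun _ h => h.1
  finite_zeros := (ha.ae_analyticOnNhd_su11Function hL).mono fun _ h _ hK hKU =>
    h.1.finite_zeros_inter_compact (convex_ball 0 1).isPreconnected h.2 hK hKU
  locallyIntegrable := locallyIntegrableOn_su11Density L
  integrable_zeroSum _ hφ hφs hφU := (ha.integral_zeroSum hL hφ.continuous hφs hφU).1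
  integral_zeroSum _ hφ hφs hφU := (ha.integral_zeroSum hL hφ.continuous hφs hφU).2

end Random

/-! ### Uniqueness of the density. -/

/-- Real test functions suffice for uniqueness; this puts the defining identity in the form used by
the fundamental lemma of the calculus of variations. -/
lemma IsZeroDensity.integral_smul {Ω : Type*} [MeasurableSpace Ω] {P : Measure Ω}
    {ψ : Ω → ℂ → ℂ} {U : Set ℂ} {ρ : ℂ → ℝ} (h : IsZeroDensity P ψ U ρ) {g : ℂ → ℝ}
    (hg : ContDiff ℝ (⊤ : ℕ∞) g) (hgs : HasCompactSupport g) (hgU : tsupport g ⊆ U) :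
    Integrable (fun z => g z • ρ z) ∧
    ∫ ω, zeroSum (ψ ω) U (fun z => (g z : ℂ)) ∂P = ((∫ z, g z • ρ z : ℝ) : ℂ) := by
  have hsub : tsupport (fun z => (g z : ℂ)) ⊆ tsupport g :=
    tsupport_comp_subset Complex.ofReal_zero g
  refine ⟨?_, ?_⟩
  · have hI : IntegrableOn ρ (tsupport g) := h.locallyIntegrable.integrableOn_compact_subset
      hgU hgs.isCompact
    obtain ⟨C, hC⟩ := hg.continuous.bounded_above_of_compact_support hgs
    have h1 : IntegrableOn (fun z => g z • ρ z) (tsupport g) :=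
      Integrable.bdd_mul (c := C) hI hg.continuous.aestronglyMeasurable (Eventually.of_forall hC)
    refine (integrableOn_iff_integrable_of_support_subset fun z hz => ?_).1 h1
    exact subset_tsupport g fun h0 => hz (by simp [h0])
  · rw [h.integral_zeroSum (fun z => (g z : ℂ)) (Complex.ofRealCLM.contDiff.comp hg)
      (hgs.comp_left Complex.ofReal_zero) (hsub.trans hgU),
      setIntegral_eq_integral_of_forall_compl_eq_zero, ← integral_complex_ofReal]
    · refine integral_congr_ae (Eventually.of_forall fun z => ?_)
      simp only [smul_eq_mul, Complex.ofReal_mul]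
      ring
    · intro z hz
      rw [image_eq_zero_of_notMem_tsupport (f := g) fun h => hz (hgU h), Complex.ofReal_zero,
        mul_zero]

/-- A density of zeros in an open set is unique up to a null set. -/
lemma IsZeroDensity.ae_eq {Ω : Type*} [MeasurableSpace Ω] {P : Measure Ω}
    {ψ : Ω → ℂ → ℂ} {U : Set ℂ} (hU : IsOpen U) {ρ ρ' : ℂ → ℝ} (h : IsZeroDensity P ψ U ρ)
    (h' : IsZeroDensity P ψ U ρ') : ∀ᵐ z ∂(volume.restrict U), ρ z = ρ' z := by
  have := hU.ae_eq_zero_of_integral_contDiff_smul_eq_zero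
    (h.locallyIntegrable.sub h'.locallyIntegrable) fun g hg hgs hgU => by
      obtain ⟨i1, e1⟩ := h.integral_smul hg hgs hgU
      obtain ⟨i2, e2⟩ := h'.integral_smul hg hgs hgU
      simp only [Pi.sub_apply, smul_sub]
      rw [integral_sub i1 i2, sub_eq_zero]
      exact Complex.ofReal_injective (e1.symm.trans e2)
  rw [ae_restrict_iff' hU.measurableSet]
  filter_upwards [this] with z hz hzU
  exact sub_eq_zero.1 (hz hzU)

theorem mainTheorem8 {Ω : Type*} [MeasurableSpace Ω] (P : Measure Ω) [IsProbabilityMeasure P]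
    (L : ℕ) (hL : 1 ≤ L) (a : ℕ → Ω → ℂ) (ha : IsIIDStdComplexGaussian P a) :
    -- the series converges almost surely at all points of the disk
    (∀ᵐ ω ∂P, ∀ z ∈ Metric.ball (0 : ℂ) 1, Summable (su11Term L (fun m => a m ω) z)) ∧
    -- the covariance
    (∀ z ∈ Metric.ball (0 : ℂ) 1, ∀ z' ∈ Metric.ball (0 : ℂ) 1,
      Integrable (fun ω => su11Function L (fun m => a m ω) z *
        conj (su11Function L (fun m => a m ω) z')) P ∧
      ∫ ω, su11Function L (fun m => a m ω) z * conj (su11Function L (fun m => a m ω) z') ∂P =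
        ((1 - z * conj z') ^ L)⁻¹) ∧
    -- the density of zeros
    IsZeroDensity P (fun ω => su11Function L (fun m => a m ω)) (Metric.ball (0 : ℂ) 1)
      (fun z => (L : ℝ) / (Real.pi * (1 - ‖z‖ ^ 2) ^ 2)) ∧
    -- and it is the only one, up to a null set
    (∀ ρ : ℂ → ℝ,
      IsZeroDensity P (fun ω => su11Function L (fun m => a m ω)) (Metric.ball (0 : ℂ) 1) ρ →
      ∀ᵐ z ∂(volume.restrict (Metric.ball (0 : ℂ) 1)),
        ρ z = (L : ℝ) / (Real.pi * (1 - ‖z‖ ^ 2) ^ 2)) := by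
  refine ⟨?_, ?_, ha.isZeroDensity hL, fun ρ hρ =>
    hρ.ae_eq Metric.isOpen_ball (ha.isZeroDensity hL)⟩
  · filter_upwards [ha.ae_su11Summable hL] with ω h z hz
    exact (h z hz).of_norm
  · intro z hz z' hz'
    exact ha.covariance_su11Function hL (mem_ball_zero_iff.1 hz) (mem_ball_zero_iff.1 hz')
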